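/- For $c>0$ and $\chi>0$, a real random variable $X$ is said to follow the modified Weibull distribution $\mathcal W(c,\chi)$ if $\operatorname{sgn}(X)\,\sqrt2\,(|X|/\chi)^{c/2}$ is a standard normal random variable. Random variables $X$ and $Y$ with distribution functions $F$ and $G$ are equivalent in the upper tail if $\lim_{x\to+\infty}\frac{1-F(x)}{1-G(x)}$ exists and lies in $(0,\infty)$, and equivalent in the lower tail if $\lim_{x\to-\infty}\frac{F(x)}{G(x)}$ exists and lies in $(0,\infty)$. Let $c>0$, let $X_1,\dots,X_N$ be independent random variables with $X_i\sim\mathcal W(c,\chi_i)$, $\chi_i>0$, and let $w_1,\dots,w_N$ be non-random real numbers, not all zero. If $c=1$, suppose moreover that the maximum of $|w_1\chi_1|,\dots,|w_N\chi_N|$ is attained at only one index. Put $$\hat\chi=\Bigl(\sum_{i=1}^N|w_i\chi_i|^{\frac{c}{c-1}}\Bigr)^{\frac{c-1}{c}}\quad\text{if } c>1,\qquad \hat\chi=\max_{1\le i\le N}|w_i\chi_i|\quad\text{if } c\le1 .$$ Then $\hat\chi>0$, and $S_N=w_1X_1+\dots+w_NX_N$ is equivalent, both in the upper tail and in the lower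 tail, to $Z\sim\mathcal W(c,\hat\chi)$. -/

import Mathlib

open MeasureTheory ProbabilityTheory Filter Topology

noncomputable section

/-- `X ∼ W(c, χ)` under `P`: the exponent `c` and the scale `χ` are positive and
`sgn(X) √2 (|X| / χ) ^ (c / 2)` is a standard normal random variable. -/
structure IsModifiedWeibull {Ω : Type*} [MeasurableSpace Ω] (c χ : ℝ) (X : Ω → ℝ)
    (P : Measure Ω) : Prop where
  exponent_pos : 0 < c
  scale_pos : 0 < χ
  aemeasurable : AEMeasurable X P
  hasLaw : HasLaw (fun ω => Real.sign (X ω) * √2 * (|X ω| / χ) ^ (c / 2)) (gaussianReal 0 1) P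

/-- `X` and `Y`, with distribution functions `F` and `G`, are equivalent in the upper tail:
`(1 - F x) / (1 - G x)` has a limit in `(0, ∞)` as `x → +∞`. -/
def UpperTailEquivalent {Ω Ω' : Type*} [MeasurableSpace Ω] [MeasurableSpace Ω']
    (X : Ω → ℝ) (P : Measure Ω) (Y : Ω' → ℝ) (Q : Measure Ω') : Prop :=
  ∃ l : ℝ, 0 < l ∧
    Tendsto (fun x => (1 - cdf (P.map X) x) / (1 - cdf (Q.map Y) x)) atTop (𝓝 l)

/-- `X` and `Y`, with distribution functions `F` and `G`, are equivalent in the lower tail: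
`F x / G x` has a limit in `(0, ∞)` as `x → -∞`. -/
def LowerTailEquivalent {Ω Ω' : Type*} [MeasurableSpace Ω] [MeasurableSpace Ω']
    (X : Ω → ℝ) (P : Measure Ω) (Y : Ω' → ℝ) (Q : Measure Ω') : Prop :=
  ∃ l : ℝ, 0 < l ∧
    Tendsto (fun x => cdf (P.map X) x / cdf (Q.map Y) x) atBot (𝓝 l)

/-- The scale parameter of the weighted sum: `(∑ |wᵢ χᵢ| ^ (c / (c - 1))) ^ ((c - 1) / c)` if
`c > 1`, and `maxᵢ |wᵢ χᵢ|` if `c ≤ 1`. -/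
def sumScale {N : ℕ} (c : ℝ) (χ w : Fin N → ℝ) : ℝ :=
  if 1 < c then (∑ i, |w i * χ i| ^ (c / (c - 1))) ^ ((c - 1) / c)
  else ⨆ i, |w i * χ i|

end

/-! In the coordinate v in which it is Gaussian with density proportional to exp(-v²), each weighted
summand is a multiple of an odd power of v, so the Gaussian tail estimate gives P(wᵢXᵢ > x) ~ K
x^(-c/2) exp(-(x/a)^c) with a = |wᵢχᵢ|. This is `HasWeibullTail`. The heart of the proof is that
convolution preserves this form, polynomial factor included; tail equivalence then follows by
dividing two such asymptotics with the same scale.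

For c < 1 the sum is large because one summand is: x^c is asymptotically flat under shifts, the
event that both summands exceed x/2 is negligible, and the constants add (`HasWeibullTail.conv`).
Ties between scales are therefore harmless.

For c = 1 shifting the tail by y multiplies it by exp(y/m), so a summand Y of smaller scale only
contributes the factor E exp(Y/m) (`HasWeibullTail.conv_of_integrable`). At a tie this moment is
infinite, hence the uniqueness hypothesis.

For c > 1 both summands share the excess, and Laplace's method applies. Minimising (u/a)^c + (t/b)^c
over u + t = 1 gives shares proportional to a^p and b^p, p = c/(c-1), and the minimum d^(-c) with d
= (a^p + b^p)^(1/p). The Gaussian coordinate of the added variable fluctuates by O(1) around the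
optimum, so integrating it out yields only a constant and the factor x^(-c/2) of the other tail
survives (`OptimalSplit.hasWeibullTail_conv`).

The lower tail is the upper tail for the weights -w, whose scale is the same; since the laws have no
atoms, strict and weak inequalities are interchangeable. -/

noncomputable section

/-! ### Signed powers and the Weibull laws -/

/-- The odd extension `sgn(v) |v| ^ p` of the power function. -/
def signedPow (p v : ℝ) : ℝ := (max v 0) ^ p - (max (-v) 0) ^ p

/-- The modified Weibull distribution `W(c, b)`, extended by the Dirac mass at `0` for `b = 0`. -/
def weibullReal (c b : ℝ) : Measure ℝ :=
  (gaussianReal 0 (1 / 2)).map (fun v => b * signedPow (2 / c) v)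

lemma continuous_signedPow {p : ℝ} (hp : 0 ≤ p) : Continuous (signedPow p) := by
  unfold signedPow
  exact ((continuous_id.max continuous_const).rpow_const fun _ => Or.inr hp).sub
    ((continuous_neg.max continuous_const).rpow_const fun _ => Or.inr hp)

lemma signedPow_of_nonneg {p v : ℝ} (hp : 0 < p) (hv : 0 ≤ v) : signedPow p v = v ^ p := by
  simp [signedPow, hv, Real.zero_rpow hp.ne']

lemma signedPow_neg (p v : ℝ) : signedPow p (-v) = -signedPow p v := by
  simp [signedPow]

lemma signedPow_of_nonpos {p v : ℝ} (hp : 0 < p) (hv : v ≤ 0) : signedPow p v = -(-v) ^ p := by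
  rw [← signedPow_of_nonneg hp (neg_nonneg.2 hv), signedPow_neg, neg_neg]

lemma signedPow_eq_sign_mul {p : ℝ} (hp : 0 < p) (v : ℝ) :
    signedPow p v = Real.sign v * |v| ^ p := by
  rcases lt_trichotomy v 0 with h | h | h
  · rw [signedPow_of_nonpos hp h.le, Real.sign_of_neg h, abs_of_neg h]; ring
  · simp [h, signedPow]
  · rw [signedPow_of_nonneg hp h.le, Real.sign_of_pos h, abs_of_pos h]; ring

lemma signedPow_signedPow {p q : ℝ} (hp : 0 < p) (hq : 0 < q) (hpq : q * p = 1) (v : ℝ) :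
    signedPow p (signedPow q v) = v := by
  have key : ∀ u : ℝ, 0 ≤ u → signedPow p (signedPow q u) = u := by
    intro u hu
    rw [signedPow_of_nonneg hq hu, signedPow_of_nonneg hp (by positivity), ← Real.rpow_mul hu,
      hpq, Real.rpow_one]
  rcases le_total 0 v with h | h
  · exact key v h
  · have := key (-v) (by linarith)
    rw [signedPow_neg, signedPow_neg] at this
    linarith

lemma signedPow_injective {p : ℝ} (hp : 0 < p) : Function.Injective (signedPow p) :=
  Function.LeftInverse.injective (g := signedPow p⁻¹)
    (signedPow_signedPow (inv_pos.2 hp) hp (mul_inv_cancel₀ hp.ne'))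

lemma signedPow_strictMono {p : ℝ} (hp : 0 < p) : StrictMono (signedPow p) := by
  refine Monotone.strictMono_of_injective ?_ (signedPow_injective hp)
  intro u v huv
  unfold signedPow
  gcongr

lemma measurable_mul_signedPow {c : ℝ} (hc : 0 < c) (b : ℝ) :
    Measurable (fun v => b * signedPow (2 / c) v) :=
  ((continuous_signedPow (by positivity)).measurable).const_mul b

lemma isProbabilityMeasure_weibullReal {c : ℝ} (hc : 0 < c) (b : ℝ) :
    IsProbabilityMeasure (weibullReal c b) :=
  Measure.isProbabilityMeasure_map (measurable_mul_signedPow hc b).aemeasurable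

lemma integral_weibullReal {c : ℝ} (hc : 0 < c) (b : ℝ) {f : ℝ → ℝ} (hf : Measurable f) :
    ∫ y, f y ∂(weibullReal c b) =
      ∫ v, f (b * signedPow (2 / c) v) ∂(gaussianReal 0 (1 / 2)) := by
  rw [weibullReal, integral_map (measurable_mul_signedPow hc b).aemeasurable
    hf.aestronglyMeasurable]

lemma gaussianPDFReal_half (v : ℝ) :
    gaussianPDFReal 0 (1 / 2) v = (√Real.pi)⁻¹ * Real.exp (-v ^ 2) := by
  have h : ((1 / 2 : NNReal) : ℝ) = 1 / 2 := by norm_num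
  rw [gaussianPDFReal, h, show 2 * Real.pi * (1 / 2) = Real.pi by ring]
  congr 2
  ring

lemma integral_gaussianReal_half (f : ℝ → ℝ) :
    ∫ v, f v ∂(gaussianReal 0 (1 / 2)) = (√Real.pi)⁻¹ * ∫ v, Real.exp (-v ^ 2) * f v := by
  rw [integral_gaussianReal_eq_integral_smul (by norm_num), ← integral_const_mul]
  refine integral_congr_ae (Eventually.of_forall fun v => ?_)
  simp only [gaussianPDFReal_half, smul_eq_mul]
  ring

lemma integrable_gaussianReal_half {f : ℝ → ℝ} (hf : Integrable fun v => Real.exp (-v ^ 2) * f v) :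
    Integrable f (gaussianReal 0 (1 / 2)) := by
  rw [gaussianReal_of_var_ne_zero _ (by norm_num : (1 / 2 : NNReal) ≠ 0),
    integrable_withDensity_iff (measurable_gaussianPDF _ _)
    (Eventually.of_forall fun _ => gaussianPDF_lt_top)]
  refine (hf.const_mul (√Real.pi)⁻¹).congr (Eventually.of_forall fun v => ?_)
  simp only [toReal_gaussianPDF, gaussianPDFReal_half]
  ring

/-- The Gaussian is symmetric and the signed power is odd. Signs of weights thus become irrelevant.
-/
lemma weibullReal_neg {c : ℝ} (hc : 0 < c) (b : ℝ) :
    weibullReal c (-b) = weibullReal c b := by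
  have h : gaussianReal 0 (1 / 2) = (gaussianReal 0 (1 / 2)).map (fun v => -v) := by
    rw [gaussianReal_map_neg, neg_zero]
  conv_rhs => rw [weibullReal, h, Measure.map_map (measurable_mul_signedPow hc b) measurable_neg]
  rw [weibullReal]
  congr 1
  ext v
  simp [signedPow_neg]

lemma weibullReal_abs {c : ℝ} (hc : 0 < c) (b : ℝ) : weibullReal c |b| = weibullReal c b := by
  rcases abs_choice b with h | h <;> rw [h]
  exact weibullReal_neg hc b

/-- Dividing the defining Gaussian variable by √2 leaves the signed power c/2 of X/χ, with variance
1/2; the signed power 2/c inverts it. -/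
lemma IsModifiedWeibull.hasLaw_weibullReal {Ω : Type*} [MeasurableSpace Ω] {c χ : ℝ} {X : Ω → ℝ}
    {P : Measure Ω} (h : IsModifiedWeibull c χ X P) : HasLaw X (weibullReal c χ) P := by
  have hc := h.exponent_pos
  have hχ := h.scale_pos
  have h2 := gaussianReal_div_const h.hasLaw (√2)
  have h3 : HasLaw (fun ω => signedPow (c / 2) (X ω / χ)) (gaussianReal 0 (1 / 2)) P := by
    convert h2 using 1
    · ext ω
      rw [signedPow_eq_sign_mul (by positivity), abs_div, abs_of_pos hχ]
      have : Real.sign (X ω / χ) = Real.sign (X ω) := by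
        rcases lt_trichotomy (X ω) 0 with h | h | h
        · rw [Real.sign_of_neg h, Real.sign_of_neg (div_neg_of_neg_of_pos h hχ)]
        · simp [h]
        · rw [Real.sign_of_pos h, Real.sign_of_pos (div_pos h hχ)]
      rw [this]
      field_simp
    · congr 1
      · simp
      · ext; simp
  refine ⟨h.aemeasurable, ?_⟩
  rw [weibullReal, ← h3.map_eq, AEMeasurable.map_map_of_aemeasurable
    (measurable_mul_signedPow hc χ).aemeasurable h3.aemeasurable]
  congr 1
  ext ω
  simp only [Function.comp]
  rw [signedPow_signedPow (by positivity) (by positivity) (by field_simp)]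
  field_simp

lemma IsModifiedWeibull.hasLaw_const_mul {Ω : Type*} [MeasurableSpace Ω] {c χ : ℝ} {X : Ω → ℝ}
    {P : Measure Ω} (h : IsModifiedWeibull c χ X P) (w : ℝ) :
    HasLaw (fun ω => w * X ω) (weibullReal c |w * χ|) P := by
  have hX := h.hasLaw_weibullReal
  refine ⟨hX.aemeasurable.const_mul w, ?_⟩
  have : (fun ω => w * X ω) = (fun y => w * y) ∘ X := rfl
  rw [this, ← AEMeasurable.map_map_of_aemeasurable (measurable_const_mul w).aemeasurable
    hX.aemeasurable, hX.map_eq, weibullReal_abs h.exponent_pos, weibullReal, weibullReal,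
    Measure.map_map (measurable_const_mul w) (measurable_mul_signedPow h.exponent_pos χ)]
  congr 1
  ext v
  simp [mul_assoc]

lemma weibullReal_zero (c : ℝ) : weibullReal c 0 = Measure.dirac 0 := by
  simp [weibullReal]

lemma weibullReal_real_Ioi {c b x : ℝ} (hc : 0 < c) (hb : 0 < b) (hx : 0 < x) :
    (weibullReal c b).real (Set.Ioi x) =
      (gaussianReal 0 (1 / 2)).real (Set.Ioi ((x / b) ^ (c / 2))) := by
  rw [weibullReal, map_measureReal_apply (measurable_mul_signedPow hc b) measurableSet_Ioi]
  congr 1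
  ext v
  simp only [Set.mem_preimage, Set.mem_Ioi]
  rw [← (signedPow_strictMono (p := 2 / c) (by positivity)).lt_iff_lt (b := v),
    signedPow_of_nonneg (v := (x / b) ^ (c / 2)) (by positivity) (by positivity),
    ← Real.rpow_mul (by positivity), show c / 2 * (2 / c) = 1 by field_simp, Real.rpow_one,
    div_lt_iff₀ hb, mul_comm b]

/-! ### Convolutions: tails and atoms -/

lemma measurable_real_Ioi (μ : Measure ℝ) [IsProbabilityMeasure μ] :
    Measurable fun x => μ.real (Set.Ioi x) :=
  Antitone.measurable fun _ _ h => measureReal_mono (Set.Ioi_subset_Ioi h)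

lemma conv_apply_eq_lintegral (μ ν : Measure ℝ) [IsProbabilityMeasure μ] [IsProbabilityMeasure ν]
    {s : Set ℝ} (hs : MeasurableSet s) : (μ ∗ ν) s = ∫⁻ y, μ ((fun x => x + y) ⁻¹' s) ∂ν := by
  rw [Measure.conv_comm, ← lintegral_indicator_one hs,
    Measure.lintegral_conv (measurable_one.indicator hs)]
  refine lintegral_congr fun y => ?_
  rw [← lintegral_indicator_one (hs.preimage (measurable_add_const y))]
  refine lintegral_congr fun x => ?_
  rw [add_comm]
  rfl

lemma conv_real_Ioi (μ ν : Measure ℝ) [IsProbabilityMeasure μ] [IsProbabilityMeasure ν]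
    (x : ℝ) : (μ ∗ ν).real (Set.Ioi x) = ∫ y, μ.real (Set.Ioi (x - y)) ∂ν := by
  rw [measureReal_def, conv_apply_eq_lintegral μ ν measurableSet_Ioi]
  have : ∀ y : ℝ, (fun z => z + y) ⁻¹' Set.Ioi x = Set.Ioi (x - y) := fun y => by
    ext; simp [sub_lt_iff_lt_add]
  simp_rw [this]
  rw [integral_eq_lintegral_of_nonneg_ae (Eventually.of_forall fun _ => measureReal_nonneg)
    ((measurable_real_Ioi μ).comp (measurable_const_sub x)).aestronglyMeasurable]
  simp

lemma nullSingletonClass_conv (μ ν : Measure ℝ) [IsProbabilityMeasure μ] [IsProbabilityMeasure ν]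
    [NullSingletonClass μ] : NullSingletonClass (μ ∗ ν) := by
  refine ⟨fun x => ?_⟩
  rw [conv_apply_eq_lintegral μ ν (measurableSet_singleton x)]
  have : ∀ y : ℝ, (fun z => z + y) ⁻¹' {x} = {x - y} := fun y => by
    ext; simp [← sub_eq_add_neg, eq_sub_iff_add_eq]
  simp [this]

lemma nullSingletonClass_weibullReal {c b : ℝ} (hc : 0 < c) (hb : 0 < b) :
    NullSingletonClass (weibullReal c b) := by
  have := nullSingletonClass_gaussianReal (μ := 0) (v := 1 / 2) (by norm_num)
  refine ⟨fun x => ?_⟩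
  rw [weibullReal, Measure.map_apply (measurable_mul_signedPow hc b) (measurableSet_singleton x)]
  refine Set.Subsingleton.measure_zero ?_ _
  refine Set.subsingleton_singleton.preimage fun u v huv => ?_
  exact signedPow_injective (p := 2 / c) (by positivity) (mul_left_cancel₀ hb.ne' huv)

/-! ### Weibull-type tails: examples and uniform bounds -/

/-- The tail of `μ` is asymptotically `K x ^ (-c / 2) exp (-(x / a) ^ c)`. -/
def HasWeibullTail (c a K : ℝ) (μ : Measure ℝ) : Prop :=
  Tendsto (fun x => μ.real (Set.Ioi x) * (x ^ (c / 2) * Real.exp ((x / a) ^ c))) atTop (𝓝 K)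

lemma integral_eq_inv_mul_integral_add_div {u : ℝ} (hu : 0 < u) (f : ℝ → ℝ) :
    ∫ v, f v = u⁻¹ * ∫ z, f (u + z / u) := by
  have h1 := Measure.integral_comp_div (fun y => f (u + y)) u
  have h2 : ∫ y, f (u + y) = ∫ y, f y := integral_add_left_eq_self f u
  rw [h1, h2, abs_of_pos hu, smul_eq_mul, inv_mul_cancel_left₀ hu.ne']

/-- The overshoot of a Gaussian above u has order 1/u. With v = u + z/u, exp(u² - v²) = exp(-2z -
z²/u²), dominated by exp(-2z), whose integral over z > 0 is 1/2. -/
lemma tendsto_gaussianReal_half_Ioi :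
    Tendsto (fun u => (gaussianReal 0 (1 / 2)).real (Set.Ioi u) * (u * Real.exp (u ^ 2))) atTop
      (𝓝 ((√Real.pi)⁻¹ * (1 / 2))) := by
  have hint : IntegrableOn (fun z : ℝ => Real.exp (-2 * z)) (Set.Ioi 0) :=
    integrableOn_exp_mul_Ioi (by norm_num) 0
  have hlim : Tendsto (fun u : ℝ => ∫ z in Set.Ioi (0 : ℝ), Real.exp (-2 * z - z ^ 2 / u ^ 2)) atTop
      (𝓝 (∫ z in Set.Ioi (0 : ℝ), Real.exp (-2 * z))) := by
    refine tendsto_integral_filter_of_dominated_convergence (fun z => Real.exp (-2 * z))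
      (Eventually.of_forall fun u => by fun_prop) (Eventually.of_forall fun u => ?_) hint ?_
    · refine Eventually.of_forall fun z => ?_
      rw [Real.norm_eq_abs, Real.abs_exp]
      gcongr
      have : 0 ≤ z ^ 2 / u ^ 2 := by positivity
      linarith
    · refine Eventually.of_forall fun z => ?_
      have h : Tendsto (fun u : ℝ => z ^ 2 / u ^ 2) atTop (𝓝 0) :=
        tendsto_const_nhds.div_atTop (tendsto_pow_atTop (by norm_num))
      simpa [Function.comp_def] using (Real.continuous_exp.tendsto _).comp (h.const_sub (-2 * z))
  rw [integral_exp_mul_Ioi (by norm_num)] at hlim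
  have hlim2 := hlim.const_mul (√Real.pi)⁻¹
  simp only [mul_zero, Real.exp_zero, neg_div_neg_eq] at hlim2
  refine hlim2.congr' ?_
  filter_upwards [eventually_gt_atTop 0] with u hu
  have h1 : (gaussianReal 0 (1 / 2)).real (Set.Ioi u) =
      ∫ v, (Set.Ioi u).indicator 1 v ∂(gaussianReal 0 (1 / 2)) := by
    rw [integral_indicator_one measurableSet_Ioi]
  rw [h1, integral_gaussianReal_half, integral_eq_inv_mul_integral_add_div hu,
    ← integral_indicator measurableSet_Ioi, mul_assoc, mul_assoc]
  congr 1
  have h2 : ∀ I E : ℝ, u⁻¹ * (I * (u * E)) = E * I := fun I E => by field_simp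
  rw [h2, ← integral_const_mul]
  refine integral_congr_ae (Eventually.of_forall fun z => ?_)
  simp only [Set.indicator, Set.mem_Ioi, Pi.one_apply]
  have : u < u + z / u ↔ 0 < z := by
    rw [lt_add_iff_pos_right, div_pos_iff_of_pos_right hu]
  simp only [this]
  split_ifs
  · rw [mul_one, ← Real.exp_add]
    congr 1
    field_simp
    ring
  · simp

lemma tendsto_rpow_div_rpow_atTop {c b : ℝ} (hc : 0 < c) (hb : 0 < b) :
    Tendsto (fun x : ℝ => (x / b) ^ c) atTop atTop :=
  (tendsto_rpow_atTop hc).comp (tendsto_id.atTop_div_const hb)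

lemma hasWeibullTail_weibullReal {c b : ℝ} (hc : 0 < c) (hb : 0 < b) :
    ∃ K, 0 < K ∧ HasWeibullTail c b K (weibullReal c b) := by
  refine ⟨(√Real.pi)⁻¹ * (1 / 2) * b ^ (c / 2), by positivity, ?_⟩
  have h := (tendsto_gaussianReal_half_Ioi.comp
    (tendsto_rpow_div_rpow_atTop (half_pos hc) hb)).mul_const (b ^ (c / 2))
  refine h.congr' ?_
  filter_upwards [eventually_gt_atTop 0] with x hx
  simp only [Function.comp]
  rw [weibullReal_real_Ioi hc hb hx, ← Real.rpow_natCast ((x / b) ^ (c / 2)) 2,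
    ← Real.rpow_mul (by positivity), Real.div_rpow hx.le hb.le (c / 2)]
  have : 0 < b ^ (c / 2) := by positivity
  rw [show c / 2 * ((2 : ℕ) : ℝ) = c by push_cast; ring]
  field_simp

/-- A smaller scale gives a negligible tail. -/
lemma HasWeibullTail.of_scale_lt {c a b K : ℝ} {μ : Measure ℝ} (hc : 0 < c) (hb : 0 < b)
    (hba : b < a) (h : HasWeibullTail c b K μ) : HasWeibullTail c a 0 μ := by
  have ha : 0 < a := hb.trans hba
  have hd : 0 < (b ^ c)⁻¹ - (a ^ c)⁻¹ := by
    have : b ^ c < a ^ c := Real.rpow_lt_rpow hb.le hba hc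
    have h0 : 0 < b ^ c := by positivity
    exact sub_pos.2 (inv_strictAnti₀ h0 this)
  have h1 : Tendsto (fun x : ℝ => Real.exp (-(((b ^ c)⁻¹ - (a ^ c)⁻¹) * x ^ c))) atTop (𝓝 0) :=
    Real.tendsto_exp_atBot.comp (tendsto_neg_atTop_atBot.comp
      ((tendsto_rpow_atTop hc).const_mul_atTop hd))
  have h2 := Tendsto.mul h h1
  rw [mul_zero] at h2
  refine h2.congr' ?_
  filter_upwards [eventually_gt_atTop 0] with x hx
  rw [mul_assoc, mul_assoc, ← Real.exp_add, Real.div_rpow hx.le hb.le, Real.div_rpow hx.le ha.le]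
  congr 3
  field_simp
  ring

lemma hasWeibullTail_dirac_zero (c a : ℝ) : HasWeibullTail c a 0 (Measure.dirac 0) := by
  refine tendsto_const_nhds.congr' ?_
  filter_upwards [eventually_gt_atTop 0] with x hx
  simp [measureReal_def, hx.le]

lemma HasWeibullTail.exists_le {c a K : ℝ} {μ : Measure ℝ} [IsProbabilityMeasure μ] (hc : 0 < c)
    (ha : 0 < a) (h : HasWeibullTail c a K μ) : ∃ C, 0 < C ∧ ∀ x, 1 ≤ x →
      μ.real (Set.Ioi x) ≤ C * (x ^ (-(c / 2)) * Real.exp (-(x / a) ^ c)) := by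
  have h1 := h.eventually (gt_mem_nhds (lt_add_one K))
  obtain ⟨x₀, hx₀⟩ := eventually_atTop.1 h1
  -- The limit controls only x ≥ x₀; on [1, x₀] the probability is at most 1 and the increasing
  -- weight is at most B.
  set B := (max x₀ 1) ^ (c / 2) * Real.exp ((max x₀ 1 / a) ^ c)
  refine ⟨max (K + 1) B, lt_max_of_lt_right (by positivity), fun x hx => ?_⟩
  have hx0 : 0 < x := by linarith
  have hW : x ^ (-(c / 2)) * Real.exp (-(x / a) ^ c) =
      (x ^ (c / 2) * Real.exp ((x / a) ^ c))⁻¹ := by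
    rw [Real.rpow_neg hx0.le, Real.exp_neg, mul_inv]
  rw [hW, ← div_eq_mul_inv, le_div_iff₀ (by positivity)]
  rcases le_total x₀ x with hle | hle
  · exact (hx₀ x hle).le.trans (le_max_left _ _)
  · refine le_trans ?_ (le_max_right _ _)
    calc _ ≤ 1 * (x ^ (c / 2) * Real.exp ((x / a) ^ c)) := by
          exact mul_le_mul_of_nonneg_right measureReal_le_one (by positivity)
      _ ≤ B := by
          rw [one_mul]
          have : x ≤ max x₀ 1 := hle.trans (le_max_left _ _)
          simp only [B]
          gcongr

/-- Giving up the polynomial factor buys a bound on the whole line, needed where the argument x - y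
is small or negative. -/
lemma HasWeibullTail.exists_le_exp {c a K : ℝ} {μ : Measure ℝ} [IsProbabilityMeasure μ]
    (hc : 0 < c) (ha : 0 < a) (h : HasWeibullTail c a K μ) : ∃ C, 0 < C ∧ ∀ x,
      μ.real (Set.Ioi x) ≤ C * Real.exp (-(max x 0 / a) ^ c) := by
  obtain ⟨C, hC, hle⟩ := h.exists_le hc ha
  refine ⟨max C (Real.exp ((1 / a) ^ c)), lt_max_of_lt_left hC, fun x => ?_⟩
  rcases le_total 1 x with h1 | h1
  · have h0 : 0 ≤ x := by linarith
    rw [max_eq_left h0]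
    calc _ ≤ C * (x ^ (-(c / 2)) * Real.exp (-(x / a) ^ c)) := hle x h1
      _ ≤ C * (1 * Real.exp (-(x / a) ^ c)) := by
          have := Real.rpow_le_one_of_one_le_of_nonpos h1 (by linarith : -(c / 2) ≤ 0)
          gcongr
      _ ≤ _ := by
          rw [one_mul]
          exact mul_le_mul_of_nonneg_right (le_max_left _ _) (Real.exp_pos _).le
  · have h2 : (max x 0 / a) ^ c ≤ (1 / a) ^ c := by
      have : max x 0 ≤ 1 := max_le h1 zero_le_one
      gcongr
    calc μ.real (Set.Ioi x) ≤ 1 := measureReal_le_one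
      _ ≤ Real.exp ((1 / a) ^ c) * Real.exp (-(max x 0 / a) ^ c) := by
          rw [← Real.exp_add]
          exact Real.one_le_exp (by linarith)
      _ ≤ _ := mul_le_mul_of_nonneg_right (le_max_right _ _) (Real.exp_pos _).le

/-! ### Shifted tails and the case c < 1 -/

lemma rpow_le_tangent {c u v : ℝ} (hc : 0 ≤ c) (hc1 : c ≤ 1) (hu : 0 < u) (hv : 0 ≤ v) :
    v ^ c ≤ u ^ c + c * u ^ (c - 1) * (v - u) := by
  have hs : -1 ≤ v / u - 1 := by
    have : 0 ≤ v / u := by positivity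
    linarith
  have h := mul_le_mul_of_nonneg_left (rpow_one_add_le_one_add_mul_self hs hc hc1)
    (by positivity : 0 ≤ u ^ c)
  rw [add_sub_cancel, ← Real.mul_rpow hu.le (by positivity), mul_div_cancel₀ _ hu.ne'] at h
  refine h.trans_eq ?_
  rw [Real.rpow_sub_one hu.ne']
  field_simp

/-- By concavity the increment lies between the tangent estimates at x and at x - y, and both slopes
tend to 0. -/
lemma tendsto_rpow_sub_rpow_sub {c : ℝ} (hc : 0 < c) (hc1 : c < 1) (y : ℝ) :
    Tendsto (fun x : ℝ => x ^ c - (x - y) ^ c) atTop (𝓝 0) := by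
  have h0 : Tendsto (fun x : ℝ => x ^ (c - 1)) atTop (𝓝 0) := by
    simpa using tendsto_rpow_neg_atTop (show 0 < 1 - c by linarith)
  have hs : Tendsto (fun x : ℝ => x - y) atTop atTop := tendsto_atTop_add_const_right _ _ tendsto_id
  have h1 : Tendsto (fun x : ℝ => c * x ^ (c - 1) * y) atTop (𝓝 0) := by
    simpa using (h0.const_mul c).mul_const y
  have h2 : Tendsto (fun x : ℝ => c * (x - y) ^ (c - 1) * y) atTop (𝓝 0) := by
    simpa using ((h0.comp hs).const_mul c).mul_const y
  refine tendsto_of_tendsto_of_tendsto_of_le_of_le' h1 h2 ?_ ?_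
  · filter_upwards [eventually_gt_atTop 0, hs.eventually_gt_atTop 0] with x hx hxy
    have := rpow_le_tangent hc.le hc1.le hx hxy.le
    linarith
  · filter_upwards [eventually_gt_atTop 0, hs.eventually_gt_atTop 0] with x hx hxy
    have := rpow_le_tangent hc.le hc1.le hxy hx.le
    linarith

/-- Pointwise limit for the dominated convergence arguments: used with l = 0 when c < 1 and with l =
y when c = 1. -/
lemma HasWeibullTail.tendsto_sub {c m K l y : ℝ} {μ : Measure ℝ} (hm : 0 < m)
    (h : HasWeibullTail c m K μ) (hl : Tendsto (fun x : ℝ => x ^ c - (x - y) ^ c) atTop (𝓝 l)) :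
    Tendsto (fun x => μ.real (Set.Ioi (x - y)) * (x ^ (c / 2) * Real.exp ((x / m) ^ c))) atTop
      (𝓝 (K * Real.exp (l / m ^ c))) := by
  have hs : Tendsto (fun x : ℝ => x - y) atTop atTop := tendsto_atTop_add_const_right _ _ tendsto_id
  have h1 : Tendsto (fun x : ℝ => (1 + y / (x - y)) ^ (c / 2)) atTop (𝓝 1) := by
    have : Tendsto (fun x : ℝ => 1 + y / (x - y)) atTop (𝓝 (1 + 0)) :=
      (tendsto_const_nhds.div_atTop hs).const_add 1
    simpa using this.rpow_const (p := c / 2) (by simp)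
  have h2 := (Real.continuous_exp.tendsto _).comp (hl.div_const (m ^ c))
  have h3 := ((h.comp hs).mul h1).mul h2
  rw [mul_one] at h3
  refine h3.congr' ?_
  filter_upwards [eventually_gt_atTop 0, hs.eventually_gt_atTop 0] with x hx hxy
  simp only [Function.comp]
  have e1 : 1 + y / (x - y) = x / (x - y) := by field_simp; ring
  have e2 : Real.exp ((x ^ c - (x - y) ^ c) / m ^ c) =
      Real.exp ((x / m) ^ c) / Real.exp (((x - y) / m) ^ c) := by
    rw [← Real.exp_sub, Real.div_rpow hx.le hm.le, Real.div_rpow hxy.le hm.le, sub_div]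
  rw [e1, e2, Real.div_rpow hx.le hxy.le]
  have : 0 < (x - y) ^ (c / 2) := by positivity
  field_simp

/-- For y ≤ x/2 one has x - y ≥ x/2 ≥ 1, so the uniform bound applies and the polynomial factors at
x and x - y differ by at most 2^(c/2). -/
lemma HasWeibullTail.exists_sub_le {c m K : ℝ} {μ : Measure ℝ} [IsProbabilityMeasure μ]
    (hc : 0 < c) (hm : 0 < m) (h : HasWeibullTail c m K μ) :
    ∃ C, 0 < C ∧ ∀ x y, 2 ≤ x → y ≤ x / 2 →
      μ.real (Set.Ioi (x - y)) * (x ^ (c / 2) * Real.exp ((x / m) ^ c)) ≤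
        C * Real.exp ((x / m) ^ c - ((x - y) / m) ^ c) := by
  obtain ⟨C, hC, hle⟩ := h.exists_le hc hm
  refine ⟨C * 2 ^ (c / 2), by positivity, fun x y hx hy => ?_⟩
  have hx0 : 0 < x := by linarith
  have hxy : 0 < x - y := by linarith
  have h1 : (x - y) ^ (-(c / 2)) * x ^ (c / 2) ≤ 2 ^ (c / 2) := by
    rw [Real.rpow_neg hxy.le, inv_mul_le_iff₀ (by positivity), ← Real.mul_rpow hxy.le zero_le_two]
    exact Real.rpow_le_rpow hx0.le (by linarith) (by positivity)
  calc _ ≤ C * ((x - y) ^ (-(c / 2)) * Real.exp (-((x - y) / m) ^ c)) *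
        (x ^ (c / 2) * Real.exp ((x / m) ^ c)) :=
      mul_le_mul_of_nonneg_right (hle _ (by linarith)) (by positivity)
    _ = C * ((x - y) ^ (-(c / 2)) * x ^ (c / 2)) *
        Real.exp ((x / m) ^ c - ((x - y) / m) ^ c) := by
      rw [sub_eq_add_neg ((x / m) ^ c), Real.exp_add]; ring
    _ ≤ _ := by gcongr

lemma prod_real_eq_integral (μ ν : Measure ℝ) [IsProbabilityMeasure μ] [IsProbabilityMeasure ν]
    {A : Set (ℝ × ℝ)} (hA : MeasurableSet A) :
    (μ.prod ν).real A = ∫ y, μ.real ((fun z => (z, y)) ⁻¹' A) ∂ν := by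
  rw [measureReal_def, Measure.prod_apply_symm hA, integral_eq_lintegral_of_nonneg_ae
    (Eventually.of_forall fun _ => measureReal_nonneg)
    (measurable_measure_prodMk_right hA).ennreal_toReal.aestronglyMeasurable]
  simp

lemma prod_real_halfplane (μ ν : Measure ℝ) [IsProbabilityMeasure μ] [IsProbabilityMeasure ν]
    (x : ℝ) : (μ.prod ν).real {p | p.2 ≤ x / 2 ∧ x < p.1 + p.2} =
      ∫ y, (Set.Iic (x / 2)).indicator (fun y => μ.real (Set.Ioi (x - y))) y ∂ν := by
  have hA : MeasurableSet {p : ℝ × ℝ | p.2 ≤ x / 2 ∧ x < p.1 + p.2} :=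
    (measurableSet_le measurable_snd measurable_const).inter
      (measurableSet_lt measurable_const (measurable_fst.add measurable_snd))
  rw [prod_real_eq_integral μ ν hA]
  refine integral_congr_ae (Eventually.of_forall fun y => ?_)
  by_cases hy : y ≤ x / 2
  · rw [Set.indicator_of_mem (Set.mem_Iic.2 hy)]
    refine congrArg μ.real ?_
    ext z
    simp [hy, sub_lt_iff_lt_add]
  · rw [Set.indicator_of_notMem (by simpa using hy)]
    simp [hy]

/-- If `z + y > x`, then `y ≤ x / 2`, or `z ≤ x / 2`, or both exceed `x / 2`. -/
lemma conv_real_Ioi_eq_add (μ ν : Measure ℝ) [IsProbabilityMeasure μ] [IsProbabilityMeasure ν]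
    (x : ℝ) : (μ ∗ ν).real (Set.Ioi x) =
      ∫ y, (Set.Iic (x / 2)).indicator (fun y => μ.real (Set.Ioi (x - y))) y ∂ν +
      ∫ z, (Set.Iic (x / 2)).indicator (fun z => ν.real (Set.Ioi (x - z))) z ∂μ +
      μ.real (Set.Ioi (x / 2)) * ν.real (Set.Ioi (x / 2)) := by
  set A := {p : ℝ × ℝ | p.2 ≤ x / 2 ∧ x < p.1 + p.2}
  set B := {p : ℝ × ℝ | p.1 ≤ x / 2 ∧ x < p.1 + p.2}
  set D : Set (ℝ × ℝ) := Set.Ioi (x / 2) ×ˢ Set.Ioi (x / 2)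
  have hB : MeasurableSet B := (measurableSet_le measurable_fst measurable_const).inter
      (measurableSet_lt measurable_const (measurable_fst.add measurable_snd))
  have hD : MeasurableSet D := measurableSet_Ioi.prod measurableSet_Ioi
  have hBswap : (μ.prod ν).real B = (ν.prod μ).real A := by
    rw [← Measure.prod_swap, map_measureReal_apply measurable_swap hB]
    congr 1
    ext p
    simp [A, B, add_comm]
  rw [← prod_real_halfplane μ ν, ← prod_real_halfplane ν μ, ← hBswap,
    ← measureReal_prod_prod, Measure.conv, map_measureReal_apply (by fun_prop) measurableSet_Ioi,
    ← measureReal_union _ hB, ← measureReal_union _ hD]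
  · congr 1
    ext ⟨z, y⟩
    simp only [Set.mem_preimage, Set.mem_Ioi, B, D, Set.mem_union, Set.mem_ofPred_eq,
      Set.mem_prod]
    constructor
    · intro h
      by_cases hy : y ≤ x / 2
      · exact Or.inl (Or.inl ⟨hy, h⟩)
      · by_cases hz : z ≤ x / 2
        · exact Or.inl (Or.inr ⟨hz, h⟩)
        · exact Or.inr ⟨not_le.1 hz, not_le.1 hy⟩
    · rintro ((h | h) | h)
      · exact h.2
      · exact h.2
      · linarith [h.1, h.2]
  · refine Set.disjoint_left.2 ?_
    rintro ⟨z, y⟩ h hd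
    simp only [B, D, Set.mem_union, Set.mem_ofPred_eq, Set.mem_prod, Set.mem_Ioi] at h hd
    rcases h with h | h <;> linarith [h.1, hd.1, hd.2]
  · refine Set.disjoint_left.2 ?_
    rintro ⟨z, y⟩ h hd
    simp only [B, Set.mem_ofPred_eq] at h hd
    linarith [h.1, h.2, hd.1]

/-- Dominated convergence, with integrand tending to K for each fixed y. For 0 < y ≤ x/2 the tangent
at x - y and x - y ≥ y give x^c - (x-y)^c ≤ c(x-y)^(c-1) y ≤ c y^c (in units of m). The factor c < 1
gained here is what makes the dominating moment finite. -/
lemma HasWeibullTail.tendsto_integral_indicator {c m K : ℝ} {μ ν : Measure ℝ}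
    [IsProbabilityMeasure μ] [IsProbabilityMeasure ν] (hc : 0 < c) (hc1 : c < 1) (hm : 0 < m)
    (h : HasWeibullTail c m K μ)
    (hi : Integrable (fun y => Real.exp (c * (max y 0 / m) ^ c)) ν) :
    Tendsto (fun x => (∫ y, (Set.Iic (x / 2)).indicator (fun y => μ.real (Set.Ioi (x - y))) y ∂ν) *
      (x ^ (c / 2) * Real.exp ((x / m) ^ c))) atTop (𝓝 K) := by
  obtain ⟨C, hC, hle⟩ := h.exists_sub_le hc hm
  have hK : ∫ _, K ∂ν = K := by simp
  simp_rw [← integral_mul_const]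
  conv => rw [← hK]
  refine tendsto_integral_filter_of_dominated_convergence
    (fun y => C * Real.exp (c * (max y 0 / m) ^ c)) (Eventually.of_forall fun x => ?_) ?_
    (hi.const_mul C) (Eventually.of_forall fun y => ?_)
  · exact ((((measurable_real_Ioi μ).comp (measurable_const_sub x)).indicator
      measurableSet_Iic).mul_const _).aestronglyMeasurable
  · filter_upwards [eventually_ge_atTop 2] with x hx
    refine Eventually.of_forall fun y => ?_
    have hx0 : 0 < x := by linarith
    rw [Real.norm_of_nonneg (mul_nonneg (Set.indicator_nonneg (fun _ _ => measureReal_nonneg) _)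
      (by positivity))]
    by_cases hy : y ≤ x / 2
    · rw [Set.indicator_of_mem (Set.mem_Iic.2 hy)]
      refine (hle x y hx hy).trans ?_
      gcongr
      rcases le_total y 0 with hy0 | hy0
      · have : (x / m) ^ c ≤ ((x - y) / m) ^ c := by
          have : x ≤ x - y := by linarith
          gcongr
        have h2 : 0 ≤ c * (max y 0 / m) ^ c := by positivity
        linarith
      · rw [max_eq_left hy0]
        rcases hy0.eq_or_lt with rfl | hy0
        · simp [Real.zero_rpow hc.ne']
        have hxy : 0 < x - y := by linarith
        have h1 := rpow_le_tangent hc.le hc1.le (div_pos hxy hm) (div_pos hx0 hm).le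
        have h2 : ((x - y) / m) ^ (c - 1) ≤ (y / m) ^ (c - 1) :=
          Real.rpow_le_rpow_of_nonpos (div_pos hy0 hm) (by gcongr; linarith) (by linarith)
        have h3 : (y / m) ^ (c - 1) * (y / m) = (y / m) ^ c := by
          rw [← Real.rpow_add_one (div_pos hy0 hm).ne']; ring_nf
        have h4 : x / m - (x - y) / m = y / m := by ring
        rw [h4] at h1
        calc _ ≤ c * ((x - y) / m) ^ (c - 1) * (y / m) := by linarith
          _ ≤ c * (y / m) ^ (c - 1) * (y / m) := by gcongr
          _ = _ := by rw [mul_assoc, h3]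
    · rw [Set.indicator_of_notMem (by simpa using hy), zero_mul]
      positivity
  · have := h.tendsto_sub hm (tendsto_rpow_sub_rpow_sub hc hc1 y)
    rw [zero_div, Real.exp_zero, mul_one] at this
    refine this.congr' ?_
    filter_upwards [eventually_ge_atTop (2 * y)] with x hx
    rw [Set.indicator_of_mem (Set.mem_Iic.2 (by linarith))]

/-- Subadditivity of z^c bounds exp((x/m)^c) by the square of exp((x/2m)^c). Each tail absorbs one
such factor and one (x/2)^(c/2), leaving a multiple of x^(-c/2). -/
lemma HasWeibullTail.tendsto_mul_half {c m K₁ K₂ : ℝ} {μ ν : Measure ℝ} (hc : 0 < c) (hc1 : c < 1)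
    (hm : 0 < m) (hμ : HasWeibullTail c m K₁ μ) (hν : HasWeibullTail c m K₂ ν) :
    Tendsto (fun x => μ.real (Set.Ioi (x / 2)) * ν.real (Set.Ioi (x / 2)) *
      (x ^ (c / 2) * Real.exp ((x / m) ^ c))) atTop (𝓝 0) := by
  have hs : Tendsto (fun x : ℝ => x / 2) atTop atTop := tendsto_id.atTop_div_const (by norm_num)
  have h0 : Tendsto (fun x : ℝ => (2 : ℝ) ^ c * x ^ (-(c / 2))) atTop (𝓝 0) := by
    simpa using (tendsto_rpow_neg_atTop (half_pos hc)).const_mul ((2 : ℝ) ^ c)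
  have h1 := ((hμ.comp hs).mul (hν.comp hs)).mul h0
  rw [mul_zero] at h1
  refine tendsto_of_tendsto_of_tendsto_of_le_of_le' tendsto_const_nhds h1 ?_ ?_
  · filter_upwards [eventually_gt_atTop 0] with x hx
    have h1 : 0 ≤ μ.real (Set.Ioi (x / 2)) := measureReal_nonneg
    have h2 : 0 ≤ ν.real (Set.Ioi (x / 2)) := measureReal_nonneg
    positivity
  · filter_upwards [eventually_gt_atTop 0] with x hx
    have h1 : 0 ≤ μ.real (Set.Ioi (x / 2)) := measureReal_nonneg
    have h2 : 0 ≤ ν.real (Set.Ioi (x / 2)) := measureReal_nonneg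
    have h3 : (x / m) ^ c ≤ (x / 2 / m) ^ c + (x / 2 / m) ^ c := by
      have := Real.rpow_add_le_add_rpow (p := c) (by positivity : 0 ≤ x / 2 / m)
        (by positivity : 0 ≤ x / 2 / m) hc.le hc1.le
      rwa [← add_div, add_halves] at this
    have h4 : Real.exp ((x / m) ^ c) ≤ Real.exp ((x / 2 / m) ^ c) * Real.exp ((x / 2 / m) ^ c) := by
      rw [← Real.exp_add]; gcongr
    have h5 : x ^ (c / 2) = (x / 2) ^ (c / 2) * (x / 2) ^ (c / 2) * (2 ^ c * x ^ (-(c / 2))) := by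
      rw [← Real.rpow_add (by positivity), add_halves, Real.div_rpow hx.le zero_le_two,
        ← mul_assoc, div_mul_cancel₀ _ (by positivity), ← Real.rpow_add hx]
      ring_nf
    simp only [Function.comp]
    rw [h5]
    calc _ ≤ μ.real (Set.Ioi (x / 2)) * ν.real (Set.Ioi (x / 2)) *
        ((x / 2) ^ (c / 2) * (x / 2) ^ (c / 2) * (2 ^ c * x ^ (-(c / 2))) *
          (Real.exp ((x / 2 / m) ^ c) * Real.exp ((x / 2 / m) ^ c))) := by gcongr
      _ = _ := by ring

lemma HasWeibullTail.conv {c m K₁ K₂ : ℝ} {μ ν : Measure ℝ}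
    [IsProbabilityMeasure μ] [IsProbabilityMeasure ν] (hc : 0 < c) (hc1 : c < 1) (hm : 0 < m)
    (hμ : HasWeibullTail c m K₁ μ) (hν : HasWeibullTail c m K₂ ν)
    (iμ : Integrable (fun y => Real.exp (c * (max y 0 / m) ^ c)) μ)
    (iν : Integrable (fun y => Real.exp (c * (max y 0 / m) ^ c)) ν) :
    HasWeibullTail c m (K₁ + K₂) (μ ∗ ν) := by
  have := ((hμ.tendsto_integral_indicator hc hc1 hm iν).add
    (hν.tendsto_integral_indicator hc hc1 hm iμ)).add (hμ.tendsto_mul_half hc hc1 hm hν)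
  rw [add_zero] at this
  refine this.congr fun x => ?_
  rw [conv_real_Ioi_eq_add]
  ring

lemma integrable_exp_rpow_conv {c m : ℝ} {μ ν : Measure ℝ}
    [IsProbabilityMeasure μ] [IsProbabilityMeasure ν] (hc : 0 < c) (hc1 : c < 1) (hm : 0 < m)
    (iμ : Integrable (fun y => Real.exp (c * (max y 0 / m) ^ c)) μ)
    (iν : Integrable (fun y => Real.exp (c * (max y 0 / m) ^ c)) ν) :
    Integrable (fun y => Real.exp (c * (max y 0 / m) ^ c)) (μ ∗ ν) := by
  have hcont : Continuous fun y : ℝ => Real.exp (c * (max y 0 / m) ^ c) :=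
    Real.continuous_exp.comp (continuous_const.mul
      (((continuous_id.max continuous_const).div_const m).rpow_const fun _ => Or.inr hc.le))
  rw [Measure.conv, integrable_map_measure hcont.aestronglyMeasurable (by fun_prop)]
  refine (iμ.mul_prod iν).mono' (hcont.comp (by fun_prop)).aestronglyMeasurable
    (Eventually.of_forall fun p => ?_)
  simp only [Function.comp]
  rw [Real.norm_eq_abs, Real.abs_exp, ← Real.exp_add, ← mul_add]
  gcongr
  refine le_trans ?_ (Real.rpow_add_le_add_rpow (by positivity) (by positivity) hc.le hc1.le)
  rw [← add_div]
  have : max (p.1 + p.2) 0 ≤ max p.1 0 + max p.2 0 :=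
    max_le (add_le_add (le_max_left _ _) (le_max_left _ _)) (by positivity)
  gcongr

lemma integrable_weibullReal_iff {c : ℝ} (hc : 0 < c) (b : ℝ) {f : ℝ → ℝ} (hf : Measurable f) :
    Integrable f (weibullReal c b) ↔
      Integrable (fun v => f (b * signedPow (2 / c) v)) (gaussianReal 0 (1 / 2)) := by
  rw [weibullReal, integrable_map_measure hf.aestronglyMeasurable
    (measurable_mul_signedPow hc b).aemeasurable]
  rfl

lemma abs_signedPow {p : ℝ} (hp : 0 < p) (v : ℝ) : |signedPow p v| = |v| ^ p := by
  rcases le_total 0 v with h | h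
  · rw [signedPow_of_nonneg hp h, abs_of_nonneg h, abs_of_nonneg (by positivity)]
  · rw [signedPow_of_nonpos hp h, abs_neg, abs_of_nonpos h,
      abs_of_nonneg (Real.rpow_nonneg (by linarith) _)]

/-- In the Gaussian coordinate the integrand is at most exp(-(1-c)v²). -/
lemma integrable_exp_rpow_weibullReal {c b m : ℝ} (hc : 0 < c) (hc1 : c < 1) (hb : 0 ≤ b)
    (hbm : b ≤ m) (hm : 0 < m) :
    Integrable (fun y => Real.exp (c * (max y 0 / m) ^ c)) (weibullReal c b) := by
  have hcont : Continuous fun y : ℝ => Real.exp (c * (max y 0 / m) ^ c) :=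
    Real.continuous_exp.comp (continuous_const.mul
      (((continuous_id.max continuous_const).div_const m).rpow_const fun _ => Or.inr hc.le))
  rw [integrable_weibullReal_iff hc b hcont.measurable]
  refine integrable_gaussianReal_half ?_
  refine (integrable_exp_neg_mul_sq (show 0 < 1 - c by linarith)).mono'
    (Measurable.aestronglyMeasurable ?_) (Eventually.of_forall fun v => ?_)
  · exact (by fun_prop : Measurable fun v : ℝ => Real.exp (-v ^ 2)).mul
      (hcont.measurable.comp (measurable_mul_signedPow hc b))
  · rw [Real.norm_of_nonneg (by positivity), ← Real.exp_add]
    gcongr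
    have h1 : max (b * signedPow (2 / c) v) 0 / m ≤ |v| ^ (2 / c) := by
      rw [div_le_iff₀ hm]
      refine max_le ((le_abs_self _).trans ?_) (by positivity)
      rw [abs_mul, abs_signedPow (by positivity), abs_of_nonneg hb, mul_comm]
      gcongr
    have h2 : (max (b * signedPow (2 / c) v) 0 / m) ^ c ≤ v ^ 2 := by
      calc _ ≤ (|v| ^ (2 / c)) ^ c := by gcongr
        _ = v ^ 2 := by
          rw [← Real.rpow_mul (abs_nonneg v), div_mul_cancel₀ _ hc.ne', Real.rpow_two, sq_abs]
    nlinarith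

/-! ### The case c = 1 -/

/-- Conditioning on the second summand and letting x → ∞ under the integral. For y ≤ x/2 the shifted
bound dominates by a multiple of exp(y/m). For y > x/2 only the exponential bound is available, and
the uncompensated x^(1/2) ≤ x < 2y accounts for the weight 1 + 2|y|. -/
lemma HasWeibullTail.conv_of_integrable {m K : ℝ} {μ ν : Measure ℝ}
    [IsProbabilityMeasure μ] [IsProbabilityMeasure ν] (hm : 0 < m) (h : HasWeibullTail 1 m K μ)
    (hi : Integrable (fun y => (1 + 2 * |y|) * Real.exp (y / m)) ν) :
    HasWeibullTail 1 m (∫ y, K * Real.exp (y / m) ∂ν) (μ ∗ ν) := by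
  obtain ⟨C, hC, hle⟩ := h.exists_sub_le one_pos hm
  obtain ⟨D, hD, hle'⟩ := h.exists_le_exp one_pos hm
  unfold HasWeibullTail
  simp_rw [conv_real_Ioi, ← integral_mul_const]
  refine tendsto_integral_filter_of_dominated_convergence
    (fun y => (C + D) * ((1 + 2 * |y|) * Real.exp (y / m))) (Eventually.of_forall fun x => ?_) ?_
    (hi.const_mul _) (Eventually.of_forall fun y => ?_)
  · exact (((measurable_real_Ioi μ).comp (measurable_const_sub x)).mul_const _).aestronglyMeasurable
  · filter_upwards [eventually_ge_atTop 2] with x hx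
    refine Eventually.of_forall fun y => ?_
    have hx0 : 0 < x := by linarith
    rw [Real.norm_of_nonneg (mul_nonneg measureReal_nonneg (by positivity))]
    have hE : 0 < Real.exp (y / m) := Real.exp_pos _
    have hy1 : 0 ≤ |y| := abs_nonneg y
    rcases le_or_gt y (x / 2) with hy | hy
    · refine (hle x y hx hy).trans ?_
      rw [Real.rpow_one, Real.rpow_one, show x / m - (x - y) / m = y / m by ring, ← mul_assoc]
      refine mul_le_mul_of_nonneg_right ?_ hE.le
      nlinarith
    · have hy0 : 0 < y := by linarith
      have h1 : x ^ ((1 : ℝ) / 2) ≤ 1 + 2 * |y| := by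
        calc x ^ ((1 : ℝ) / 2) ≤ x ^ (1 : ℝ) :=
              Real.rpow_le_rpow_of_exponent_le (by linarith) (by norm_num)
          _ ≤ _ := by
              rw [Real.rpow_one]
              linarith [le_abs_self y]
      have h2 : μ.real (Set.Ioi (x - y)) ≤ D * Real.exp (-((x - y) / m)) := by
        refine (hle' (x - y)).trans ?_
        rw [Real.rpow_one]
        gcongr
        exact le_max_left _ _
      calc _ ≤ D * Real.exp (-((x - y) / m)) * ((1 + 2 * |y|) * Real.exp ((x / m) ^ (1 : ℝ))) := by
            gcongr
        _ = D * ((1 + 2 * |y|) * Real.exp (y / m)) := by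
            rw [Real.rpow_one, show y / m = -((x - y) / m) + x / m by ring, Real.exp_add]
            ring
        _ ≤ _ := by
            refine mul_le_mul_of_nonneg_right (by linarith) (by positivity)
  · have := h.tendsto_sub (y := y) (l := y) hm (by simp)
    rwa [Real.rpow_one] at this

/-- In the Gaussian coordinate the exponent is at most -(1 - b/m)v², so strictness of b < m is
essential. -/
lemma integrable_one_add_abs_mul_exp_weibullReal {b m : ℝ} (hb : 0 ≤ b) (hbm : b < m) :
    Integrable (fun y => (1 + 2 * |y|) * Real.exp (y / m)) (weibullReal 1 b) := by
  have hm : 0 < m := hb.trans_lt hbm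
  have hd : 0 < 1 - b / m := by
    rw [sub_pos, div_lt_one hm]; exact hbm
  rw [integrable_weibullReal_iff one_pos b (by fun_prop)]
  refine integrable_gaussianReal_half ?_
  have h1 := integrable_exp_neg_mul_sq hd
  have h2 := integrable_rpow_mul_exp_neg_mul_sq hd (show (-1 : ℝ) < 2 by norm_num)
  have hmeas := measurable_mul_signedPow one_pos b
  refine (h1.add (h2.const_mul (2 * b))).mono'
    (Measurable.aestronglyMeasurable ?_) (Eventually.of_forall fun v => ?_)
  · exact (by fun_prop : Measurable fun v : ℝ => Real.exp (-v ^ 2)).mul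
      ((by fun_prop : Measurable fun y : ℝ => (1 + 2 * |y|) * Real.exp (y / m)).comp hmeas)
  · rw [Real.norm_of_nonneg (by positivity)]
    simp only [Pi.add_apply, Real.rpow_two]
    have h3 : |b * signedPow (2 / 1) v| = b * v ^ 2 := by
      rw [abs_mul, abs_of_nonneg hb, abs_signedPow (by norm_num), div_one, Real.rpow_two, sq_abs]
    have h4 : b * signedPow (2 / 1) v / m ≤ b / m * v ^ 2 := by
      rw [div_mul_eq_mul_div]
      exact div_le_div_of_nonneg_right ((le_abs_self _).trans_eq h3) hm.le
    calc _ ≤ Real.exp (-v ^ 2) * ((1 + 2 * (b * v ^ 2)) * Real.exp (b / m * v ^ 2)) := by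
          rw [h3]
          gcongr
      _ = (1 + 2 * (b * v ^ 2)) * Real.exp (-(1 - b / m) * v ^ 2) := by
          rw [mul_left_comm, ← Real.exp_add]
          ring_nf
      _ = _ := by ring

lemma HasWeibullTail.conv_weibullReal_one {m b K : ℝ} {μ : Measure ℝ}
    [IsProbabilityMeasure μ] (hK : 0 < K) (h : HasWeibullTail 1 m K μ) (hb : 0 ≤ b) (hbm : b < m) :
    ∃ K', 0 < K' ∧ HasWeibullTail 1 m K' (μ ∗ weibullReal 1 b) := by
  have hm : 0 < m := hb.trans_lt hbm
  have := isProbabilityMeasure_weibullReal one_pos b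
  have hi := integrable_one_add_abs_mul_exp_weibullReal hb hbm
  refine ⟨_, ?_, h.conv_of_integrable hm hi⟩
  have hi' : Integrable (fun y => Real.exp (y / m)) (weibullReal 1 b) := by
    refine hi.mono' (by fun_prop) (Eventually.of_forall fun y => ?_)
    rw [Real.norm_eq_abs, Real.abs_exp]
    have : 0 ≤ |y| := abs_nonneg y
    exact le_mul_of_one_le_left (Real.exp_pos _).le (by linarith)
  rw [integral_const_mul]
  exact mul_pos hK (integral_exp_pos hi')

/-! ### The case c > 1: convexity and the rate function -/

lemma tangent_lt_rpow {c x y : ℝ} (hc : 1 < c) (hx : 0 < x) (hy : 0 ≤ y) (hxy : y ≠ x) :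
    x ^ c + c * x ^ (c - 1) * (y - x) < y ^ c := by
  have hs : -1 ≤ y / x - 1 := by
    have : 0 ≤ y / x := by positivity
    linarith
  have hs' : y / x - 1 ≠ 0 := by
    rw [sub_ne_zero]
    exact fun h => hxy ((div_eq_one_iff_eq hx.ne').1 h)
  have h := mul_lt_mul_of_pos_left (one_add_mul_self_lt_rpow_one_add hs hs' hc)
    (by positivity : 0 < x ^ c)
  rw [add_sub_cancel, ← Real.mul_rpow hx.le (by positivity), mul_div_cancel₀ _ hx.ne'] at h
  refine (Eq.trans_lt ?_ h)
  rw [Real.rpow_sub_one hx.ne']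
  field_simp

/-- At y = 0 the tangent equals (1-c)x^c < 0, and it increases with y. This extends the convexity
inequalities to |y|^c and to the positive part. -/
lemma tangent_neg_of_nonpos {c x y : ℝ} (hc : 1 < c) (hx : 0 < x) (hy : y ≤ 0) :
    x ^ c + c * x ^ (c - 1) * (y - x) < 0 := by
  have h : x ^ c = x ^ (c - 1) * x := by rw [← Real.rpow_add_one hx.ne']; ring_nf
  have h1 : 0 < x ^ (c - 1) := by positivity
  rw [h]
  have h2 : x + c * (y - x) < 0 := by nlinarith
  nlinarith

lemma tangent_lt_abs_rpow {c x y : ℝ} (hc : 1 < c) (hx : 0 < x) (hxy : y ≠ x) :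
    x ^ c + c * x ^ (c - 1) * (y - x) < |y| ^ c := by
  rcases le_total 0 y with h | h
  · rw [abs_of_nonneg h]
    exact tangent_lt_rpow hc hx h hxy
  · exact (tangent_neg_of_nonpos hc hx h).trans_le (by positivity)

lemma tangent_le_max_rpow {c x y : ℝ} (hc : 1 < c) (hx : 0 < x) :
    x ^ c + c * x ^ (c - 1) * (y - x) ≤ (max y 0) ^ c := by
  rcases le_total 0 y with h | h
  · rw [max_eq_left h]
    rcases eq_or_ne y x with rfl | hxy
    · simp
    · exact (tangent_lt_rpow hc hx h hxy).le
  · exact (tangent_neg_of_nonpos hc hx h).le.trans (by positivity)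

/-- One use of L'Hôpital's rule reduces the quotient to half the slope of c x^(c-1). -/
lemma tendsto_rpow_taylor_two {c x₀ : ℝ} (hx : 0 < x₀) :
    Tendsto (fun x => (x ^ c - x₀ ^ c - c * x₀ ^ (c - 1) * (x - x₀)) / (x - x₀) ^ 2) (𝓝[≠] x₀)
      (𝓝 (c * ((c - 1) * x₀ ^ (c - 2)) / 2)) := by
  have hpos : ∀ᶠ x in 𝓝[≠] x₀, 0 < x :=
    eventually_nhdsWithin_of_eventually_nhds (lt_mem_nhds hx)
  have hle : 𝓝[≠] x₀ ≤ 𝓝 x₀ := nhdsWithin_le_nhds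
  have hcont : ContinuousAt (fun x : ℝ => x ^ c) x₀ :=
    Real.continuousAt_rpow_const _ _ (Or.inl hx.ne')
  refine HasDerivAt.lhopital_zero_nhdsNE (f' := fun x => c * x ^ (c - 1) - c * x₀ ^ (c - 1))
    (g' := fun x => 2 * (x - x₀)) ?_ ?_ ?_ ?_ ?_ ?_
  · filter_upwards [hpos] with x hx
    have h1 := Real.hasDerivAt_rpow_const (x := x) (p := c) (Or.inl hx.ne')
    have h2 := ((hasDerivAt_id x).sub_const x₀).const_mul (c * x₀ ^ (c - 1))
    have h3 := (h1.sub_const (x₀ ^ c)).sub h2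
    rw [mul_one] at h3
    exact h3
  · refine Eventually.of_forall fun x => ?_
    have h1 := ((hasDerivAt_id x).sub_const x₀).pow 2
    simp only [Nat.cast_ofNat, Nat.add_one_sub_one, pow_one, mul_one, id_eq] at h1
    exact h1
  · filter_upwards [self_mem_nhdsWithin] with x hx
    exact mul_ne_zero two_ne_zero (sub_ne_zero.2 hx)
  · have : ContinuousAt (fun x => x ^ c - x₀ ^ c - c * x₀ ^ (c - 1) * (x - x₀)) x₀ := by fun_prop
    simpa using this.tendsto.mono_left hle
  · have : ContinuousAt (fun x => (x - x₀) ^ 2) x₀ := by fun_prop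
    simpa using this.tendsto.mono_left hle
  · have h1 := (Real.hasDerivAt_rpow_const (x := x₀) (p := c - 1) (Or.inl hx.ne')).tendsto_slope
    have h2 := (h1.const_mul c).div_const 2
    rw [show c - 1 - 1 = c - 2 by ring] at h2
    refine h2.congr' ?_
    filter_upwards [self_mem_nhdsWithin] with x hx
    have := sub_ne_zero.2 hx
    rw [slope_def_field]
    field_simp

/-- With `x = r ^ (2 / c)` and `v = r q`, the joint exponential rate of `X > x - y` and `Y ≈ y` for
`y = b sgn(v) |v| ^ (2 / c)` is `r ^ 2` times this. -/
def convRate (c a b q : ℝ) : ℝ := (max (1 - b * signedPow (2 / c) q) 0 / a) ^ c + q ^ 2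

lemma continuous_convRate {c : ℝ} (a b : ℝ) (hc : 0 < c) : Continuous (convRate c a b) := by
  have h := continuous_signedPow (p := 2 / c) (by positivity)
  unfold convRate
  exact ((((continuous_const.sub (continuous_const.mul h)).max continuous_const).div_const
    a).rpow_const fun _ => Or.inr hc.le).add (continuous_pow 2)

lemma sq_eq_abs_mul_signedPow_div_rpow {c b : ℝ} (hc : 0 < c) (hb : 0 < b) (q : ℝ) :
    q ^ 2 = |b * signedPow (2 / c) q| ^ c / b ^ c := by
  rw [abs_mul, abs_signedPow (by positivity), abs_of_pos hb,
    Real.mul_rpow hb.le (by positivity), ← Real.rpow_mul (abs_nonneg q), div_mul_cancel₀ _ hc.ne',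
    Real.rpow_two, sq_abs]
  field_simp

/-- The proportions `u` and `t = 1 - u` in which a large sum `X + Y` splits between `X` and `Y`,
and the resulting exponential rate `l`. -/
structure OptimalSplit (c a b u t l τ : ℝ) : Prop where
  one_lt : 1 < c
  a_pos : 0 < a
  b_pos : 0 < b
  u_pos : 0 < u
  t_pos : 0 < t
  add_eq : u + t = 1
  -- Lagrange condition: the two marginal rates u^(c-1)/a^c and t^(c-1)/b^c agree. Multiplying by u
  -- and t and adding shows that the common value l is also the minimal rate.
  u_eq : u ^ (c - 1) = l * a ^ c
  t_eq : t ^ (c - 1) = l * b ^ c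
  τ_pos : 0 < τ
  τ_eq : b * τ ^ (2 / c) = t

namespace OptimalSplit

variable {c a b u t l τ : ℝ}

lemma c_pos (h : OptimalSplit c a b u t l τ) : 0 < c := one_pos.trans h.one_lt

lemma u_rpow (h : OptimalSplit c a b u t l τ) : u ^ c = l * a ^ c * u := by
  rw [← h.u_eq, ← Real.rpow_add_one h.u_pos.ne']; ring_nf

lemma t_rpow (h : OptimalSplit c a b u t l τ) : t ^ c = l * b ^ c * t := by
  rw [← h.t_eq, ← Real.rpow_add_one h.t_pos.ne']; ring_nf

lemma mul_signedPow (h : OptimalSplit c a b u t l τ) : b * signedPow (2 / c) τ = t := by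
  have := h.c_pos
  rw [signedPow_of_nonneg (by positivity) h.τ_pos.le, h.τ_eq]

lemma rate_eq (h : OptimalSplit c a b u t l τ) : convRate c a b τ = l := by
  have hc := h.c_pos
  have ha := h.a_pos
  have hb := h.b_pos
  have e : 1 - t = u := by linarith [h.add_eq]
  rw [convRate, sq_eq_abs_mul_signedPow_div_rpow hc hb, h.mul_signedPow, e, max_eq_left h.u_pos.le,
    abs_of_pos h.t_pos, Real.div_rpow h.u_pos.le ha.le, h.u_rpow, h.t_rpow]
  have : 0 < a ^ c := by positivity
  have : 0 < b ^ c := by positivity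
  field_simp
  rw [h.add_eq, mul_one]

/-- Sum of the tangent inequalities at t and u: with equal marginal rates and u + t = 1 the linear
terms cancel. The inequality at t is strict. -/
lemma lt_rate (h : OptimalSplit c a b u t l τ) {q : ℝ} (hq : q ≠ τ) : l < convRate c a b q := by
  have hc := h.c_pos
  have ha := h.a_pos
  have hb := h.b_pos
  have hac : 0 < a ^ c := by positivity
  have hbc : 0 < b ^ c := by positivity
  set y := b * signedPow (2 / c) q with hy
  have hyt : y ≠ t := by
    rw [← h.mul_signedPow, hy]
    exact fun e => hq (signedPow_injective (p := 2 / c) (by positivity) (mul_left_cancel₀ hb.ne' e))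
  have h1 := tangent_lt_abs_rpow h.one_lt h.t_pos hyt
  have h2 := tangent_le_max_rpow (y := 1 - y) h.one_lt h.u_pos
  rw [h.t_rpow, h.t_eq] at h1
  rw [h.u_rpow, h.u_eq] at h2
  have h1' : l * t + c * l * (y - t) < |y| ^ c / b ^ c := by
    rw [lt_div_iff₀ hbc]; linarith
  have h2' : l * u + c * l * (1 - y - u) ≤ (max (1 - y) 0) ^ c / a ^ c := by
    rw [le_div_iff₀ hac]; linarith
  have e : u = 1 - t := by linarith [h.add_eq]
  rw [convRate, sq_eq_abs_mul_signedPow_div_rpow hc hb, ← hy, Real.div_rpow (by positivity) ha.le]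
  rw [e] at h2'
  linarith

/-- The first-order terms cancel, so the excess rate is the sum of the two second-order Taylor
remainders. Each is quadratic in y(q) - t, and the squared slope of y at τ converts this to q - τ.
-/
lemma tendsto_rate_quadratic (h : OptimalSplit c a b u t l τ) : ∃ M, 0 < M ∧
    Tendsto (fun q => (convRate c a b q - l) / (q - τ) ^ 2) (𝓝[≠] τ) (𝓝 M) := by
  have hc := h.c_pos
  have ha := h.a_pos
  have hb := h.b_pos
  have hu := h.u_pos
  have ht := h.t_pos
  have hτ := h.τ_pos
  have hac : 0 < a ^ c := by positivity
  have hbc : 0 < b ^ c := by positivity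
  have hc1 : 0 < c - 1 := by linarith [h.one_lt]
  set y : ℝ → ℝ := fun q => b * signedPow (2 / c) q with hy
  have hycont : Continuous y := continuous_const.mul (continuous_signedPow (by positivity))
  have hyτ : y τ = t := h.mul_signedPow
  have hyinj : ∀ q, q ≠ τ → y q ≠ t := fun q hq e => hq <| by
    rw [← hyτ] at e
    exact signedPow_injective (p := 2 / c) (by positivity) (mul_left_cancel₀ hb.ne' e)
  have hy1 : Tendsto y (𝓝[≠] τ) (𝓝[≠] t) := by
    refine tendsto_nhdsWithin_of_tendsto_nhds_of_eventually_within _ ?_ ?_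
    · have := hycont.tendsto τ
      rw [hyτ] at this
      exact this.mono_left nhdsWithin_le_nhds
    · filter_upwards [self_mem_nhdsWithin] with q hq using hyinj q hq
  have hy2 : Tendsto (fun q => 1 - y q) (𝓝[≠] τ) (𝓝[≠] u) := by
    have e : u = 1 - t := by linarith [h.add_eq]
    refine tendsto_nhdsWithin_of_tendsto_nhds_of_eventually_within _ ?_ ?_
    · rw [e]
      exact (hy1.mono_right nhdsWithin_le_nhds).const_sub 1
    · filter_upwards [self_mem_nhdsWithin] with q hq
      rw [Set.mem_compl_singleton_iff, e]
      exact fun e' => hyinj q hq (by linarith)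
  have hyd : HasDerivAt y (b * (2 / c * τ ^ (2 / c - 1))) τ := by
    have h1 := (Real.hasDerivAt_rpow_const (x := τ) (p := 2 / c) (Or.inl hτ.ne')).const_mul b
    refine h1.congr_of_eventuallyEq ?_
    filter_upwards [lt_mem_nhds hτ] with q hq
    simp only [hy]
    rw [signedPow_of_nonneg (by positivity) hq.le]
  have hs := (hyd.tendsto_slope).pow 2
  have hT := (((tendsto_rpow_taylor_two (c := c) hu).comp hy2).div_const (a ^ c)).add
    (((tendsto_rpow_taylor_two (c := c) ht).comp hy1).div_const (b ^ c))
  refine ⟨_, ?_, (hT.mul hs).congr' ?_⟩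
  · positivity
  · filter_upwards [self_mem_nhdsWithin,
      (hy1.mono_right nhdsWithin_le_nhds).eventually (lt_mem_nhds ht),
      (hy2.mono_right nhdsWithin_le_nhds).eventually (lt_mem_nhds hu)] with q hq hq1 hq2
    have hq0 : q - τ ≠ 0 := sub_ne_zero.2 hq
    have hyt : y q - t ≠ 0 := sub_ne_zero.2 (hyinj q hq)
    have e : u = 1 - t := by linarith [h.add_eq]
    have e2 : 1 - y q - u = -(y q - t) := by linarith
    simp only [Function.comp]
    rw [slope_def_field, hyτ, convRate, sq_eq_abs_mul_signedPow_div_rpow hc hb q]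
    change _ = ((max (1 - y q) 0 / a) ^ c + |y q| ^ c / b ^ c - l) / _
    rw [max_eq_left hq2.le, abs_of_pos hq1, Real.div_rpow hq2.le ha.le, h.u_rpow, h.t_rpow,
      h.u_eq, h.t_eq, e2]
    have h3 : l = l * u + l * t := by rw [← mul_add, h.add_eq, mul_one]
    generalize (1 - y q) ^ c = P at *
    generalize (y q) ^ c = Q at *
    generalize y q - t = D at *
    generalize q - τ = E at *
    field_simp
    linear_combination (a ^ c * b ^ c) * h3

/-- On a compact set the strict minimum leaves a positive gap; outside it the term q² of the rate
suffices. -/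
lemma rate_ge_far (h : OptimalSplit c a b u t l τ) {δ : ℝ} (hδ : 0 < δ) : ∃ ε, 0 < ε ∧
    ∀ q, δ ≤ |q - τ| → l + ε + ε * (q - τ) ^ 2 ≤ convRate c a b q := by
  have hl : 0 < l := by
    have h1 : 0 < l * a ^ c := by rw [← h.u_eq]; exact Real.rpow_pos_of_pos h.u_pos _
    exact pos_of_mul_pos_left h1 (Real.rpow_pos_of_pos h.a_pos _).le
  -- Since (q-τ)² ≤ 2q² + 2τ², this size makes q² ≥ B imply (1 + (q-τ)²)/4 ≤ q² - l; B ≥ 1 turns |q|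
  -- > B into q² ≥ B.
  set B := 2 * l + 1 + τ ^ 2 with hB
  set F := {q : ℝ | δ ≤ |q - τ|} ∩ Set.Icc (-B) B with hF
  have hFc : IsCompact F :=
    isCompact_Icc.inter_left (isClosed_le continuous_const (by fun_prop))
  set R : ℝ → ℝ := fun q => (convRate c a b q - l) / (1 + (q - τ) ^ 2) with hR
  have hRc : ContinuousOn R F := by
    refine (((continuous_convRate a b h.c_pos).sub continuous_const).div (by fun_prop)
      fun q => ?_).continuousOn
    positivity
  obtain ⟨ε, hε, hle⟩ : ∃ ε, 0 < ε ∧ ∀ q ∈ F, ε ≤ R q := by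
    rcases F.eq_empty_or_nonempty with he | hne
    · exact ⟨1, one_pos, by simp [he]⟩
    · obtain ⟨q₀, hq₀, hmin⟩ := hFc.exists_isMinOn hne hRc
      refine ⟨R q₀, div_pos (sub_pos.2 (h.lt_rate ?_)) (by positivity), fun q hq => hmin hq⟩
      rintro rfl
      have := hq₀.1
      simp only [sub_self, abs_zero, Set.mem_ofPred_eq] at this
      linarith
  refine ⟨min ε (1 / 4), lt_min hε (by norm_num), fun q hq => ?_⟩
  have hk : min ε (1 / 4) * (1 + (q - τ) ^ 2) ≤ convRate c a b q - l := by
    by_cases hqB : q ∈ Set.Icc (-B) B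
    · have h1 := hle q ⟨hq, hqB⟩
      rw [hR, le_div_iff₀ (by positivity)] at h1
      refine le_trans ?_ h1
      gcongr
      exact min_le_left _ _
    · have h0 : q ^ 2 ≤ convRate c a b q := by
        have ha := h.a_pos
        rw [convRate]
        have : 0 ≤ (max (1 - b * signedPow (2 / c) q) 0 / a) ^ c := by positivity
        linarith
      have hB1 : 1 ≤ B := by nlinarith [sq_nonneg τ]
      have h2 : B ≤ q ^ 2 := by
        rw [Set.mem_Icc, not_and_or, not_le, not_le] at hqB
        rcases hqB with h3 | h3 <;> nlinarith
      calc _ ≤ 1 / 4 * (1 + (q - τ) ^ 2) := by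
            gcongr
            exact min_le_right _ _
        _ ≤ q ^ 2 - l := by nlinarith [sq_nonneg (q + τ)]
        _ ≤ _ := by linarith
  linarith

/-- Half the limiting curvature serves as a lower bound near τ. The bound u/2 keeps the share of the
first summand away from 0, so its tail is evaluated at large arguments. -/
lemma rate_ge_near (h : OptimalSplit c a b u t l τ) {M : ℝ} (hM : 0 < M)
    (hlim : Tendsto (fun q => (convRate c a b q - l) / (q - τ) ^ 2) (𝓝[≠] τ) (𝓝 M)) :
    ∃ δ, 0 < δ ∧ ∀ q, |q - τ| < δ → u / 2 ≤ 1 - b * signedPow (2 / c) q ∧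
      l + M / 2 * (q - τ) ^ 2 ≤ convRate c a b q := by
  have hc := h.c_pos
  have h1 : ∀ᶠ q in 𝓝 τ, q ≠ τ → M / 2 < (convRate c a b q - l) / (q - τ) ^ 2 :=
    eventually_nhdsWithin_iff.1 (hlim.eventually (lt_mem_nhds (half_lt_self hM)))
  have h2 : ∀ᶠ q in 𝓝 τ, u / 2 < 1 - b * signedPow (2 / c) q := by
    have hcont : Continuous fun q => 1 - b * signedPow (2 / c) q :=
      continuous_const.sub (continuous_const.mul (continuous_signedPow (by positivity)))
    refine (hcont.tendsto τ).eventually (lt_mem_nhds ?_)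
    rw [h.mul_signedPow]
    linarith [h.add_eq, h.u_pos]
  obtain ⟨δ, hδ, hball⟩ := Metric.eventually_nhds_iff.1 (h1.and h2)
  refine ⟨δ, hδ, fun q hq => ?_⟩
  obtain ⟨h3, h4⟩ := hball (by rwa [Real.dist_eq])
  refine ⟨h4.le, ?_⟩
  rcases eq_or_ne q τ with rfl | hne
  · simp [h.rate_eq]
  · have h5 := h3 hne
    have : 0 < (q - τ) ^ 2 := by
      have := sub_ne_zero.2 hne
      positivity
    rw [lt_div_iff₀ this] at h5
    linarith

end OptimalSplit

/-! ### The case c > 1: Laplace's method -/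

lemma signedPow_mul {p r : ℝ} (hp : 0 < p) (hr : 0 < r) (q : ℝ) :
    signedPow p (r * q) = r ^ p * signedPow p q := by
  rcases le_total 0 q with h | h
  · rw [signedPow_of_nonneg hp h, signedPow_of_nonneg hp (by positivity), Real.mul_rpow hr.le h]
  · rw [signedPow_of_nonpos hp h, signedPow_of_nonpos hp (mul_nonpos_of_nonneg_of_nonpos hr.le h),
      ← mul_neg, Real.mul_rpow hr.le (by linarith), mul_neg]

/-- The normalized integrand of the tail of a convolution, recentred at the optimal split. -/
def convIntegrand (μ : Measure ℝ) (c b l τ r s : ℝ) : ℝ :=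
  Real.exp (-(r * τ + s) ^ 2) * μ.real (Set.Ioi (r ^ (2 / c) - b * signedPow (2 / c) (r * τ + s))) *
    (r * Real.exp (l * r ^ 2))

lemma convIntegrand_nonneg (μ : Measure ℝ) (c b l τ : ℝ) {r : ℝ} (hr : 0 ≤ r) (s : ℝ) :
    0 ≤ convIntegrand μ c b l τ r s :=
  mul_nonneg (mul_nonneg (Real.exp_pos _).le measureReal_nonneg) (by positivity)

lemma conv_weibullReal_real_Ioi {μ : Measure ℝ} [IsProbabilityMeasure μ] {c : ℝ} (hc : 0 < c)
    (b l τ r : ℝ) :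
    (μ ∗ weibullReal c b).real (Set.Ioi (r ^ (2 / c))) * (r * Real.exp (l * r ^ 2)) =
      (√Real.pi)⁻¹ * ∫ s, convIntegrand μ c b l τ r s := by
  have := isProbabilityMeasure_weibullReal hc b
  have hmeas : Measurable fun y => μ.real (Set.Ioi (r ^ (2 / c) - y)) :=
    (measurable_real_Ioi μ).comp (measurable_const_sub _)
  rw [conv_real_Ioi, integral_weibullReal hc b hmeas, integral_gaussianReal_half, mul_assoc,
    ← integral_mul_const, ← integral_add_left_eq_self _ (r * τ)]
  rfl

lemma convIntegrand_eq {μ : Measure ℝ} {c b l τ r : ℝ} (hc : 0 < c) (hr : 0 < r) (s : ℝ) :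
    convIntegrand μ c b l τ r s =
      μ.real (Set.Ioi (r ^ (2 / c) * (1 - b * signedPow (2 / c) (τ + s / r)))) *
      (r * Real.exp (r ^ 2 * (l - (τ + s / r) ^ 2))) := by
  have e : r * τ + s = r * (τ + s / r) := by field_simp
  rw [convIntegrand, e, signedPow_mul (by positivity) hr, mul_sub (r ^ (2 / c)), mul_one,
    mul_left_comm b, mul_sub (r ^ 2), sub_eq_add_neg (r ^ 2 * l), Real.exp_add]
  ring_nf

lemma measurable_convIntegrand {μ : Measure ℝ} [IsProbabilityMeasure μ] {c : ℝ} (hc : 0 < c)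
    (b l τ r : ℝ) : Measurable (convIntegrand μ c b l τ r) := by
  have h := (measurable_real_Ioi μ).comp ((measurable_const_sub (r ^ (2 / c))).comp
    ((measurable_mul_signedPow hc b).comp (measurable_const_add (r * τ))))
  exact ((by fun_prop : Measurable fun s : ℝ => Real.exp (-(r * τ + s) ^ 2)).mul h).mul_const _

lemma rpow_two_div_mul_div_rpow {c a r U : ℝ} (hc : 0 < c) (ha : 0 < a) (hr : 0 < r) (hU : 0 ≤ U) :
    (r ^ (2 / c) * U / a) ^ c = r ^ 2 * (U / a) ^ c := by
  rw [mul_div_assoc, Real.mul_rpow (by positivity) (by positivity), ← Real.rpow_mul hr.le,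
    div_mul_cancel₀ _ hc.ne', Real.rpow_two]

namespace OptimalSplit

variable {c a b u t l τ K : ℝ} {μ : Measure ℝ}

/-- The exponent r²(l - rate) is at most -εr² - εs². The first part absorbs the prefactor r, the
second gives integrability in s. -/
lemma convIntegrand_le_far (h : OptimalSplit c a b u t l τ) {D ε δ : ℝ}
    (hD : ∀ x, μ.real (Set.Ioi x) ≤ D * Real.exp (-(max x 0 / a) ^ c)) (hD0 : 0 < D) (hε : 0 < ε)
    (hfar : ∀ q, δ ≤ |q - τ| → l + ε + ε * (q - τ) ^ 2 ≤ convRate c a b q)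
    {r s : ℝ} (hr : 0 < r) (hs : δ ≤ |s / r|) :
    convIntegrand μ c b l τ r s ≤ D * (1 + ε⁻¹) * Real.exp (-ε * s ^ 2) := by
  have hc := h.c_pos
  have ha := h.a_pos
  have h1 := hfar (τ + s / r) (by simpa using hs)
  rw [convIntegrand_eq hc hr]
  set q := τ + s / r with hq
  set U := 1 - b * signedPow (2 / c) q with hU
  have hsq : r ^ 2 * (q - τ) ^ 2 = s ^ 2 := by
    rw [hq, add_sub_cancel_left]; field_simp
  have h2 := hD (r ^ (2 / c) * U)
  have h3 : max (r ^ (2 / c) * U) 0 = r ^ (2 / c) * max U 0 := by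
    rw [mul_max_of_nonneg _ _ (by positivity), mul_zero]
  rw [h3, rpow_two_div_mul_div_rpow hc ha hr (le_max_right _ _)] at h2
  have h4 : r * Real.exp (-(ε * r ^ 2)) ≤ 1 + ε⁻¹ := by
    rw [Real.exp_neg, ← div_eq_mul_inv, div_le_iff₀ (Real.exp_pos _)]
    have h5 := Real.add_one_le_exp (ε * r ^ 2)
    calc r ≤ 1 + r ^ 2 := by nlinarith [sq_nonneg (r - 1)]
      _ ≤ (1 + ε⁻¹) * (ε * r ^ 2 + 1) := by
          have : (1 + ε⁻¹) * (ε * r ^ 2 + 1) = 1 + r ^ 2 + (ε⁻¹ + ε * r ^ 2) := by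
            field_simp; ring
          rw [this]
          have : 0 ≤ ε⁻¹ + ε * r ^ 2 := by positivity
          linarith
      _ ≤ _ := by gcongr
  calc _ ≤ D * Real.exp (-(r ^ 2 * (max U 0 / a) ^ c)) * (r * Real.exp (r ^ 2 * (l - q ^ 2))) := by
        gcongr
    _ = D * (r * Real.exp (r ^ 2 * (l - convRate c a b q))) := by
        rw [convRate, ← hU, show r ^ 2 * (l - ((max U 0 / a) ^ c + q ^ 2)) =
          -(r ^ 2 * (max U 0 / a) ^ c) + r ^ 2 * (l - q ^ 2) by ring, Real.exp_add]
        ring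
    _ ≤ D * (r * Real.exp (-(ε * r ^ 2) + -ε * s ^ 2)) := by
        gcongr
        rw [← hsq]
        nlinarith [sq_nonneg r]
    _ = D * (r * Real.exp (-(ε * r ^ 2))) * Real.exp (-ε * s ^ 2) := by
        rw [Real.exp_add]; ring
    _ ≤ _ := by gcongr

/-- Since (r^(2/c) U)^(c/2) = r U^(c/2), the prefactor r is exactly what normalises the tail of `μ`;
only U^(-c/2) and the excess rate remain. -/
lemma convIntegrand_eq_near (h : OptimalSplit c a b u t l τ) {r s : ℝ} (hr : 0 < r)
    (hU : 0 < 1 - b * signedPow (2 / c) (τ + s / r)) :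
    convIntegrand μ c b l τ r s =
      (μ.real (Set.Ioi (r ^ (2 / c) * (1 - b * signedPow (2 / c) (τ + s / r)))) *
        ((r ^ (2 / c) * (1 - b * signedPow (2 / c) (τ + s / r))) ^ (c / 2) *
          Real.exp ((r ^ (2 / c) * (1 - b * signedPow (2 / c) (τ + s / r)) / a) ^ c))) *
        (1 - b * signedPow (2 / c) (τ + s / r)) ^ (-(c / 2)) *
        Real.exp (-(r ^ 2 * (convRate c a b (τ + s / r) - l))) := by
  have hc := h.c_pos
  have ha := h.a_pos
  rw [convIntegrand_eq hc hr, convRate]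
  set q := τ + s / r
  set U := 1 - b * signedPow (2 / c) q
  rw [max_eq_left hU.le, rpow_two_div_mul_div_rpow hc ha hr hU.le,
    Real.mul_rpow (by positivity) hU.le, ← Real.rpow_mul hr.le,
    show 2 / c * (c / 2) = 1 by field_simp, Real.rpow_one, Real.rpow_neg hU.le,
    show r ^ 2 * (l - q ^ 2) = r ^ 2 * (U / a) ^ c + -(r ^ 2 * ((U / a) ^ c + q ^ 2 - l)) by ring,
    Real.exp_add]
  have : 0 < U ^ (c / 2) := by positivity
  field_simp

lemma tendsto_convIntegrand (h : OptimalSplit c a b u t l τ) (hμ : HasWeibullTail c a K μ) {M : ℝ}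
    (hlim : Tendsto (fun q => (convRate c a b q - l) / (q - τ) ^ 2) (𝓝[≠] τ) (𝓝 M)) (s : ℝ) :
    Tendsto (fun r => convIntegrand μ c b l τ r s) atTop
      (𝓝 (K * u ^ (-(c / 2)) * Real.exp (-M * s ^ 2))) := by
  have hc := h.c_pos
  have hq : Tendsto (fun r : ℝ => τ + s / r) atTop (𝓝 τ) := by
    simpa using (tendsto_const_nhds (x := s)).div_atTop tendsto_id |>.const_add τ
  have hUc : Continuous fun q => 1 - b * signedPow (2 / c) q :=
    continuous_const.sub (continuous_const.mul (continuous_signedPow (by positivity)))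
  have hU : Tendsto (fun r : ℝ => 1 - b * signedPow (2 / c) (τ + s / r)) atTop (𝓝 u) := by
    have h1 := (hUc.tendsto τ).comp hq
    rw [h.mul_signedPow, show 1 - t = u by linarith [h.add_eq]] at h1
    exact h1
  have hX := (tendsto_rpow_atTop (show 0 < 2 / c by positivity)).atTop_mul_pos h.u_pos hU
  have h1 := hμ.comp hX
  have h2 := hU.rpow_const (p := -(c / 2)) (Or.inl h.u_pos.ne')
  have h3 : Tendsto (fun r : ℝ => r ^ 2 * (convRate c a b (τ + s / r) - l)) atTop
      (𝓝 (M * s ^ 2)) := by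
    rcases eq_or_ne s 0 with rfl | hs
    · simp [h.rate_eq]
    · have hq' : Tendsto (fun r : ℝ => τ + s / r) atTop (𝓝[≠] τ) := by
        refine tendsto_nhdsWithin_of_tendsto_nhds_of_eventually_within _ hq ?_
        filter_upwards [eventually_gt_atTop 0] with r hr
        simpa [hs] using hr.ne'
      refine ((hlim.comp hq').mul_const (s ^ 2)).congr' ?_
      filter_upwards [eventually_gt_atTop 0] with r hr
      simp only [Function.comp, add_sub_cancel_left]
      field_simp
  have h4 := (Real.continuous_exp.tendsto _).comp h3.neg
  rw [neg_mul]
  refine ((h1.mul h2).mul h4).congr' ?_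
  filter_upwards [eventually_gt_atTop 0, hU.eventually (lt_mem_nhds h.u_pos)] with r hr hUr
  exact (h.convIntegrand_eq_near hr hUr).symm

lemma convIntegrand_le_near (h : OptimalSplit c a b u t l τ) {C M δ : ℝ}
    (hC : ∀ x, 1 ≤ x → μ.real (Set.Ioi x) ≤ C * (x ^ (-(c / 2)) * Real.exp (-(x / a) ^ c)))
    (hC0 : 0 < C)
    (hnear : ∀ q, |q - τ| < δ → u / 2 ≤ 1 - b * signedPow (2 / c) q ∧
      l + M / 2 * (q - τ) ^ 2 ≤ convRate c a b q)
    {r s : ℝ} (hr : 0 < r) (hr1 : 1 ≤ r ^ (2 / c) * (u / 2)) (hs : |s / r| < δ) :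
    convIntegrand μ c b l τ r s ≤ C * (u / 2) ^ (-(c / 2)) * Real.exp (-(M / 2) * s ^ 2) := by
  have hc := h.c_pos
  have hu2 : 0 < u / 2 := half_pos h.u_pos
  obtain ⟨h1, h2⟩ := hnear (τ + s / r) (by simpa using hs)
  have hU := hu2.trans_le h1
  rw [h.convIntegrand_eq_near hr hU]
  set q := τ + s / r with hq
  set U := 1 - b * signedPow (2 / c) q with hU'
  have hsq : r ^ 2 * (q - τ) ^ 2 = s ^ 2 := by
    rw [hq, add_sub_cancel_left]; field_simp
  set x := r ^ (2 / c) * U with hx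
  have hx1 : 1 ≤ x := hr1.trans (mul_le_mul_of_nonneg_left h1 (by positivity))
  have hx0 : 0 < x := by linarith
  have h3 : μ.real (Set.Ioi x) * (x ^ (c / 2) * Real.exp ((x / a) ^ c)) ≤ C := by
    have h4 := hC x hx1
    rw [Real.rpow_neg hx0.le, Real.exp_neg, ← mul_inv, ← div_eq_mul_inv,
      le_div_iff₀ (by positivity)] at h4
    exact h4
  have h5 : U ^ (-(c / 2)) ≤ (u / 2) ^ (-(c / 2)) :=
    Real.rpow_le_rpow_of_nonpos hu2 h1 (by linarith)
  have h6 : Real.exp (-(r ^ 2 * (convRate c a b q - l))) ≤ Real.exp (-(M / 2) * s ^ 2) := by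
    gcongr
    rw [← hsq]
    nlinarith [sq_nonneg r]
  gcongr

/-- Dominated convergence in s, with one Gaussian bound for |s/r| < δ and another for the rest;
their sum dominates both. The limit is a Gaussian integral, hence positive. -/
lemma hasWeibullTail_conv [IsProbabilityMeasure μ] (h : OptimalSplit c a b u t l τ) (hK : 0 < K)
    (hμ : HasWeibullTail c a K μ) {d : ℝ} (hd : 0 < d) (hdl : l * d ^ c = 1) :
    ∃ K', 0 < K' ∧ HasWeibullTail c d K' (μ ∗ weibullReal c b) := by
  have hc := h.c_pos
  obtain ⟨M, hM, hlim⟩ := h.tendsto_rate_quadratic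
  obtain ⟨δ, hδ, hnear⟩ := h.rate_ge_near hM hlim
  obtain ⟨ε, hε, hfar⟩ := h.rate_ge_far hδ
  obtain ⟨C, hC0, hC⟩ := hμ.exists_le hc h.a_pos
  obtain ⟨D, hD0, hD⟩ := hμ.exists_le_exp hc h.a_pos
  have hM2 : 0 < M / 2 := half_pos hM
  have hu2 : 0 < u / 2 := half_pos h.u_pos
  have hiM := integrable_exp_neg_mul_sq hM
  have hlimit : Tendsto (fun r => ∫ s, convIntegrand μ c b l τ r s) atTop
      (𝓝 (∫ s, K * u ^ (-(c / 2)) * Real.exp (-M * s ^ 2))) := by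
    refine tendsto_integral_filter_of_dominated_convergence
      (fun s => C * (u / 2) ^ (-(c / 2)) * Real.exp (-(M / 2) * s ^ 2) +
        D * (1 + ε⁻¹) * Real.exp (-ε * s ^ 2))
      (Eventually.of_forall fun r => (measurable_convIntegrand hc b l τ r).aestronglyMeasurable)
      ?_ (((integrable_exp_neg_mul_sq hM2).const_mul _).add
        ((integrable_exp_neg_mul_sq hε).const_mul _))
      (Eventually.of_forall fun s => h.tendsto_convIntegrand hμ hlim s)
    filter_upwards [eventually_gt_atTop 0, ((tendsto_rpow_atTop
      (show 0 < 2 / c by positivity)).atTop_mul_const hu2).eventually_ge_atTop 1] with r hr hr1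
    refine Eventually.of_forall fun s => ?_
    rw [Real.norm_of_nonneg (convIntegrand_nonneg μ c b l τ hr.le s)]
    rcases lt_or_ge |s / r| δ with hs | hs
    · exact (h.convIntegrand_le_near hC hC0 hnear hr hr1 hs).trans
        (le_add_of_nonneg_right (by positivity))
    · exact (h.convIntegrand_le_far hD hD0 hε hfar hr hs).trans
        (le_add_of_nonneg_left (by positivity))
  refine ⟨(√Real.pi)⁻¹ * ∫ s, K * u ^ (-(c / 2)) * Real.exp (-M * s ^ 2), ?_, ?_⟩
  · rw [integral_const_mul]
    have := integral_exp_pos hiM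
    have := h.u_pos
    positivity
  · refine ((hlimit.const_mul (√Real.pi)⁻¹).comp
      (tendsto_rpow_atTop (half_pos hc))).congr' ?_
    filter_upwards [eventually_gt_atTop 0] with x hx
    simp only [Function.comp]
    rw [← conv_weibullReal_real_Ioi hc, ← Real.rpow_mul hx.le,
      show c / 2 * (2 / c) = 1 by field_simp, Real.rpow_one, ← Real.rpow_natCast (x ^ (c / 2)) 2,
      ← Real.rpow_mul hx.le, show c / 2 * ((2 : ℕ) : ℝ) = c by push_cast; ring,
      Real.div_rpow hx.le hd.le]
    congr 3
    have : 0 < d ^ c := by positivity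
    rw [eq_div_iff this.ne', mul_right_comm, hdl, one_mul]

end OptimalSplit

/-- Solving the Lagrange condition gives shares proportional to a^(c/(c-1)) and b^(c/(c-1));
normalisation to sum 1 fixes l = A^(-(c-1)). -/
lemma exists_optimalSplit {c a b : ℝ} (hc : 1 < c) (ha : 0 < a) (hb : 0 < b) :
    ∃ u t l τ, OptimalSplit c a b u t l τ ∧
      l * ((a ^ (c / (c - 1)) + b ^ (c / (c - 1))) ^ ((c - 1) / c)) ^ c = 1 := by
  have hc0 : 0 < c := by linarith
  have hc1 : 0 < c - 1 := by linarith
  set A := a ^ (c / (c - 1)) + b ^ (c / (c - 1)) with hA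
  have hA0 : 0 < A := by positivity
  have key : ∀ z : ℝ, 0 < z → (z ^ (c / (c - 1)) / A) ^ (c - 1) = (A ^ (c - 1))⁻¹ * z ^ c := by
    intro z hz
    rw [Real.div_rpow (by positivity) hA0.le, ← Real.rpow_mul hz.le, div_mul_cancel₀ _ hc1.ne']
    ring
  set t := b ^ (c / (c - 1)) / A with ht
  have ht0 : 0 < t := by positivity
  refine ⟨a ^ (c / (c - 1)) / A, t, (A ^ (c - 1))⁻¹, (t / b) ^ (c / 2),
    ⟨hc, ha, hb, by positivity, ht0, ?_, key a ha, key b hb, by positivity, ?_⟩, ?_⟩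
  · rw [ht, ← add_div, ← hA, div_self hA0.ne']
  · rw [← Real.rpow_mul (by positivity), show c / 2 * (2 / c) = 1 by field_simp, Real.rpow_one]
    field_simp
  · rw [← Real.rpow_mul hA0.le, div_mul_cancel₀ _ hc0.ne', inv_mul_cancel₀ (by positivity)]

lemma HasWeibullTail.conv_weibullReal {c a b K : ℝ} {μ : Measure ℝ} [IsProbabilityMeasure μ]
    (hc : 1 < c) (ha : 0 < a) (hb : 0 < b) (hK : 0 < K) (hμ : HasWeibullTail c a K μ) :
    ∃ K', 0 < K' ∧ HasWeibullTail c
      ((a ^ (c / (c - 1)) + b ^ (c / (c - 1))) ^ ((c - 1) / c)) K' (μ ∗ weibullReal c b) := by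
  obtain ⟨u, t, l, τ, h, hl⟩ := exists_optimalSplit hc ha hb
  exact h.hasWeibullTail_conv hK hμ (by positivity) hl

/-! ### Induction over the summands -/

/-- Induction principle for the law of a sum of independent variables. -/
lemma iIndepFun.law_sum_induction {Ω ι : Type*} [MeasurableSpace Ω] {P : Measure Ω}
    [IsProbabilityMeasure P] [Fintype ι] [DecidableEq ι] {Y : ι → Ω → ℝ} {ν : ι → Measure ℝ}
    (hY : ∀ i, HasLaw (Y i) (ν i) P) (hindep : iIndepFun Y P) (i₀ : ι)
    {Φ : Finset ι → Measure ℝ → Prop} (base : Φ {i₀} (ν i₀))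
    (step : ∀ (s : Finset ι) (j : ι) (μ : Measure ℝ), i₀ ∈ s → j ∉ s → IsProbabilityMeasure μ →
      Φ s μ → Φ (insert j s) (μ ∗ ν j)) :
    Φ Finset.univ (P.map fun ω => ∑ i, Y i ω) := by
  have hmeas : ∀ i, AEMeasurable (Y i) P := fun i => (hY i).aemeasurable
  -- Only sets containing `i₀` are visited: the empty sum is a point mass at 0, which cannot start
  -- the induction.
  have key : ∀ s : Finset ι, i₀ ∉ s → Φ (insert i₀ s) (P.map (∑ i ∈ insert i₀ s, Y i)) := by
    intro s
    induction s using Finset.induction_on with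
    | empty =>
      intro _
      simpa [(hY i₀).map_eq] using base
    | insert j s hj ih =>
      intro h
      rw [Finset.mem_insert, not_or] at h
      have hj' : j ∉ insert i₀ s := by
        rw [Finset.mem_insert, not_or]
        exact ⟨Ne.symm h.1, hj⟩
      have hsum : AEMeasurable (∑ i ∈ insert i₀ s, Y i) P :=
        Finset.aemeasurable_sum _ fun i _ => hmeas i
      rw [Finset.insert_comm, Finset.sum_insert hj', add_comm,
        (hindep.indepFun_finsetSum_of_notMem₀ hmeas hj').map_add_eq_map_conv_map₀ hsum (hmeas j),
        (hY j).map_eq]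
      exact step _ _ _ (Finset.mem_insert_self _ _) hj' (Measure.isProbabilityMeasure_map hsum)
        (ih h.2)
  have h := key (Finset.univ.erase i₀) (Finset.notMem_erase _ _)
  rw [Finset.insert_erase (Finset.mem_univ _)] at h
  convert h using 2
  ext ω
  simp

lemma conv_weibullReal_zero (c : ℝ) (μ : Measure ℝ) [IsProbabilityMeasure μ] :
    μ ∗ weibullReal c 0 = μ := by
  rw [weibullReal_zero, Measure.conv_dirac_zero]

section Sum

variable {Ω ι : Type*} [MeasurableSpace Ω] {P : Measure Ω} [IsProbabilityMeasure P] [Fintype ι]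
  {Y : ι → Ω → ℝ} {c : ℝ} {a : ι → ℝ}

lemma hasWeibullTail_sum_of_one_lt (hc : 1 < c) (ha : ∀ i, 0 ≤ a i) {i₀ : ι} (hi₀ : 0 < a i₀)
    (hY : ∀ i, HasLaw (Y i) (weibullReal c (a i)) P) (hindep : iIndepFun Y P) :
    NullSingletonClass (P.map fun ω => ∑ i, Y i ω) ∧ ∃ K, 0 < K ∧
      HasWeibullTail c ((∑ i, a i ^ (c / (c - 1))) ^ ((c - 1) / c)) K
        (P.map fun ω => ∑ i, Y i ω) := by
  classical
  have hc0 : 0 < c := by linarith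
  have hc1 : 0 < c - 1 := by linarith
  refine iIndepFun.law_sum_induction hY hindep i₀ (Φ := fun s μ => NullSingletonClass μ ∧ ∃ K,
    0 < K ∧ HasWeibullTail c ((∑ i ∈ s, a i ^ (c / (c - 1))) ^ ((c - 1) / c)) K μ) ?_ ?_
  · refine ⟨nullSingletonClass_weibullReal hc0 hi₀, ?_⟩
    rw [Finset.sum_singleton, ← Real.rpow_mul hi₀.le,
      show c / (c - 1) * ((c - 1) / c) = 1 by field_simp, Real.rpow_one]
    exact hasWeibullTail_weibullReal hc0 hi₀
  · rintro s j μ hi hj hμ ⟨hnull, K, hK, htail⟩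
    have := isProbabilityMeasure_weibullReal hc0 (a j)
    refine ⟨nullSingletonClass_conv μ _, ?_⟩
    rw [Finset.sum_insert hj]
    -- A zero weight gives a point mass at 0 and adds nothing to the power sum.
    rcases (ha j).eq_or_lt with h0 | h0
    · rw [← h0, Real.zero_rpow (by positivity), zero_add, conv_weibullReal_zero]
      exact ⟨K, hK, htail⟩
    · have hpos : 0 < ∑ i ∈ s, a i ^ (c / (c - 1)) :=
        Finset.sum_pos' (fun i _ => Real.rpow_nonneg (ha i) _) ⟨i₀, hi, Real.rpow_pos_of_pos hi₀ _⟩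
      have h1 := htail.conv_weibullReal hc (by positivity) h0 hK
      rwa [← Real.rpow_mul hpos.le, show (c - 1) / c * (c / (c - 1)) = 1 by field_simp,
        Real.rpow_one, add_comm] at h1

lemma hasWeibullTail_sum_of_eq_one (ha : ∀ i, 0 ≤ a i) {i₀ : ι} (hi₀ : 0 < a i₀)
    (hlt : ∀ j, j ≠ i₀ → a j < a i₀)
    (hY : ∀ i, HasLaw (Y i) (weibullReal 1 (a i)) P) (hindep : iIndepFun Y P) :
    NullSingletonClass (P.map fun ω => ∑ i, Y i ω) ∧ ∃ K, 0 < K ∧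
      HasWeibullTail 1 (a i₀) K (P.map fun ω => ∑ i, Y i ω) := by
  classical
  refine iIndepFun.law_sum_induction hY hindep i₀ (Φ := fun _ μ => NullSingletonClass μ ∧ ∃ K,
    0 < K ∧ HasWeibullTail 1 (a i₀) K μ) ?_ ?_
  · exact ⟨nullSingletonClass_weibullReal one_pos hi₀, hasWeibullTail_weibullReal one_pos hi₀⟩
  · rintro s j μ hi hj hμ ⟨hnull, K, hK, htail⟩
    have := isProbabilityMeasure_weibullReal one_pos (a j)
    have hji : j ≠ i₀ := fun h => hj (h ▸ hi)
    exact ⟨nullSingletonClass_conv μ _, htail.conv_weibullReal_one hK (ha j) (hlt j hji)⟩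

lemma exists_hasWeibullTail_weibullReal_of_le {c b m : ℝ} (hc : 0 < c) (hb : 0 ≤ b) (hbm : b ≤ m) :
    ∃ K, 0 ≤ K ∧ HasWeibullTail c m K (weibullReal c b) := by
  rcases hb.eq_or_lt with rfl | hb
  · exact ⟨0, le_rfl, by rw [weibullReal_zero]; exact hasWeibullTail_dirac_zero c m⟩
  · obtain ⟨K, hK, h⟩ := hasWeibullTail_weibullReal hc hb
    rcases hbm.eq_or_lt with rfl | hbm
    · exact ⟨K, hK.le, h⟩
    · exact ⟨0, le_rfl, h.of_scale_lt hc hb hbm⟩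

/-- The induction also carries the exponential moment that each convolution step requires of both
factors. Summands of smaller scale enter with constant 0, tied ones with a positive constant. -/
lemma hasWeibullTail_sum_of_lt_one (hc : 0 < c) (hc1 : c < 1) (ha : ∀ i, 0 ≤ a i) {i₀ : ι}
    (hi₀ : 0 < a i₀) (hle : ∀ j, a j ≤ a i₀)
    (hY : ∀ i, HasLaw (Y i) (weibullReal c (a i)) P) (hindep : iIndepFun Y P) :
    NullSingletonClass (P.map fun ω => ∑ i, Y i ω) ∧ ∃ K, 0 < K ∧
      HasWeibullTail c (a i₀) K (P.map fun ω => ∑ i, Y i ω) := by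
  classical
  have h := iIndepFun.law_sum_induction hY hindep i₀ (Φ := fun _ μ =>
    (NullSingletonClass μ ∧ Integrable (fun y => Real.exp (c * (max y 0 / a i₀) ^ c)) μ) ∧
      ∃ K, 0 < K ∧ HasWeibullTail c (a i₀) K μ) ?_ ?_
  · exact ⟨h.1.1, h.2⟩
  · exact ⟨⟨nullSingletonClass_weibullReal hc hi₀,
      integrable_exp_rpow_weibullReal hc hc1 hi₀.le le_rfl hi₀⟩, hasWeibullTail_weibullReal hc hi₀⟩
  · rintro s j μ hi hj hμ ⟨⟨hnull, hint⟩, K, hK, htail⟩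
    have := isProbabilityMeasure_weibullReal hc (a j)
    have hint' := integrable_exp_rpow_weibullReal hc hc1 (ha j) (hle j) hi₀
    obtain ⟨K', hK', htail'⟩ := exists_hasWeibullTail_weibullReal_of_le hc (ha j) (hle j)
    exact ⟨⟨nullSingletonClass_conv μ _, integrable_exp_rpow_conv hc hc1 hi₀ hint hint'⟩,
      K + K', by positivity, htail.conv hc hc1 hi₀ htail' hint hint'⟩

end Sum

/-! ### From tail asymptotics to tail equivalence -/

lemma one_sub_cdf_eq (μ : Measure ℝ) [IsProbabilityMeasure μ] (x : ℝ) :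
    1 - cdf μ x = μ.real (Set.Ioi x) := by
  rw [cdf_eq_real, ← Set.compl_Iic, probReal_compl_eq_one_sub measurableSet_Iic]

/-- The event X ≤ x is -X ≥ -x; absence of atoms lets the closed half-line be replaced by the open
one. -/
lemma cdf_map_eq_neg {Ω : Type*} [MeasurableSpace Ω] {P : Measure Ω} [IsProbabilityMeasure P]
    {X : Ω → ℝ} (hX : AEMeasurable X P) [NullSingletonClass (P.map fun ω => -X ω)] (x : ℝ) :
    cdf (P.map X) x = (P.map fun ω => -X ω).real (Set.Ioi (-x)) := by
  have := Measure.isProbabilityMeasure_map hX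
  rw [cdf_eq_real, measureReal_congr (Ioi_ae_eq_Ici (μ := P.map fun ω => -X ω)),
    map_measureReal_apply_of_aemeasurable hX measurableSet_Iic,
    map_measureReal_apply_of_aemeasurable (f := fun ω => -X ω) hX.neg measurableSet_Ici]
  congr 1
  ext ω
  simp

lemma HasWeibullTail.tendsto_div {c d K K' : ℝ} {μ ν : Measure ℝ}
    (hμ : HasWeibullTail c d K μ) (hν : HasWeibullTail c d K' ν) (hK' : 0 < K') :
    Tendsto (fun x => μ.real (Set.Ioi x) / ν.real (Set.Ioi x)) atTop (𝓝 (K / K')) := by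
  refine (Tendsto.div hμ hν hK'.ne').congr' ?_
  filter_upwards [eventually_gt_atTop 0] with x hx
  exact mul_div_mul_right _ _ (by positivity)

section Equivalence

variable {Ω Ω' : Type*} [MeasurableSpace Ω] [MeasurableSpace Ω'] {P : Measure Ω} {Q : Measure Ω'}
  [IsProbabilityMeasure P] [IsProbabilityMeasure Q] {X : Ω → ℝ} {Y : Ω' → ℝ} {c d K K' : ℝ}

lemma upperTailEquivalent_of_hasWeibullTail (hX : AEMeasurable X P) (hY : AEMeasurable Y Q)
    (hK : 0 < K) (hK' : 0 < K') (tX : HasWeibullTail c d K (P.map X))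
    (tY : HasWeibullTail c d K' (Q.map Y)) : UpperTailEquivalent X P Y Q := by
  have := Measure.isProbabilityMeasure_map hX
  have := Measure.isProbabilityMeasure_map hY
  refine ⟨K / K', by positivity, ?_⟩
  simp_rw [one_sub_cdf_eq]
  exact tX.tendsto_div tY hK'

lemma lowerTailEquivalent_of_hasWeibullTail_neg (hX : AEMeasurable X P) (hY : AEMeasurable Y Q)
    (hK : 0 < K) (hK' : 0 < K')
    (nX : NullSingletonClass (P.map fun ω => -X ω)) (nY : NullSingletonClass (Q.map fun ω => -Y ω))
    (tX : HasWeibullTail c d K (P.map fun ω => -X ω))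
    (tY : HasWeibullTail c d K' (Q.map fun ω => -Y ω)) : LowerTailEquivalent X P Y Q := by
  refine ⟨K / K', by positivity, ?_⟩
  simp_rw [cdf_map_eq_neg hX, cdf_map_eq_neg hY]
  exact (tX.tendsto_div tY hK').comp tendsto_neg_atBot_atTop

end Equivalence

lemma sumScale_of_forall_le {N : ℕ} {c : ℝ} (hc : c ≤ 1) {χ w : Fin N → ℝ} {i₀ : Fin N}
    (h : ∀ j, |w j * χ j| ≤ |w i₀ * χ i₀|) : sumScale c χ w = |w i₀ * χ i₀| := by
  have : Nonempty (Fin N) := ⟨i₀⟩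
  rw [sumScale, if_neg (not_lt.2 hc)]
  exact le_antisymm (ciSup_le h)
    (le_ciSup (f := fun i => |w i * χ i|) (Set.finite_range _).bddAbove i₀)

lemma sumScale_neg {N : ℕ} (c : ℝ) (χ w : Fin N → ℝ) : sumScale c χ (-w) = sumScale c χ w := by
  simp [sumScale]

lemma hasWeibullTail_weighted_sum {Ω : Type*} [MeasurableSpace Ω] {P : Measure Ω}
    [IsProbabilityMeasure P] {N : ℕ} {c : ℝ} {χ w : Fin N → ℝ} {X : Fin N → Ω → ℝ}
    (hX : ∀ i, IsModifiedWeibull c (χ i) (X i) P) (hindep : iIndepFun X P) (hw : ∃ i, w i ≠ 0)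
    (hone : c = 1 → ∃ i, ∀ j, j ≠ i → |w j * χ j| < |w i * χ i|) :
    0 < sumScale c χ w ∧ NullSingletonClass (P.map fun ω => ∑ i, w i * X i ω) ∧
      ∃ K, 0 < K ∧ HasWeibullTail c (sumScale c χ w) K (P.map fun ω => ∑ i, w i * X i ω) := by
  obtain ⟨k, hk⟩ := hw
  have hc : 0 < c := (hX k).exponent_pos
  have hka : 0 < |w k * χ k| := abs_pos.2 (mul_ne_zero hk (hX k).scale_pos.ne')
  have hY : ∀ i, HasLaw (fun ω => w i * X i ω) (weibullReal c |w i * χ i|) P :=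
    fun i => (hX i).hasLaw_const_mul (w i)
  have hindep' : iIndepFun (fun i ω => w i * X i ω) P :=
    hindep.comp (fun i x => w i * x) fun i => measurable_const_mul (w i)
  have ha : ∀ i, 0 ≤ |w i * χ i| := fun i => abs_nonneg _
  rcases lt_or_ge 1 c with h1 | h1
  · refine ⟨?_, ?_⟩
    · rw [sumScale, if_pos h1]
      exact Real.rpow_pos_of_pos (Finset.sum_pos' (fun i _ => Real.rpow_nonneg (ha i) _)
        ⟨k, Finset.mem_univ _, Real.rpow_pos_of_pos hka _⟩) _
    · rw [sumScale, if_pos h1]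
      exact hasWeibullTail_sum_of_one_lt h1 ha hka hY hindep'
  · rcases h1.eq_or_lt with rfl | h1
    · obtain ⟨i₀, hi₀⟩ := hone rfl
      have hle : ∀ j, |w j * χ j| ≤ |w i₀ * χ i₀| := fun j => by
        rcases eq_or_ne j i₀ with rfl | h
        · exact le_rfl
        · exact (hi₀ j h).le
      have hpos := hka.trans_le (hle k)
      rw [sumScale_of_forall_le le_rfl hle]
      exact ⟨hpos, hasWeibullTail_sum_of_eq_one ha hpos hi₀ hY hindep'⟩
    · have : Nonempty (Fin N) := ⟨k⟩
      obtain ⟨i₀, hle⟩ := Finite.exists_max fun i => |w i * χ i|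
      have hpos := hka.trans_le (hle k)
      rw [sumScale_of_forall_le h1.le hle]
      exact ⟨hpos, hasWeibullTail_sum_of_lt_one hc h1 ha hpos hle hY hindep'⟩

end

theorem corollary2 {Ω : Type*} [MeasurableSpace Ω] (P : Measure Ω) [IsProbabilityMeasure P]
    (N : ℕ) (c : ℝ) (χ w : Fin N → ℝ) (X : Fin N → Ω → ℝ)
    (hX : ∀ i, IsModifiedWeibull c (χ i) (X i) P)
    (hindep : iIndepFun X P)
    (hw : ∃ i, w i ≠ 0)
    (hone : c = 1 → ∃ i, ∀ j, j ≠ i → |w j * χ j| < |w i * χ i|) :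
    0 < sumScale c χ w ∧
      ∀ {Ω' : Type*} [MeasurableSpace Ω'] (Q : Measure Ω') [IsProbabilityMeasure Q] (Z : Ω' → ℝ),
        IsModifiedWeibull c (sumScale c χ w) Z Q →
          UpperTailEquivalent (fun ω => ∑ i, w i * X i ω) P Z Q ∧
          LowerTailEquivalent (fun ω => ∑ i, w i * X i ω) P Z Q := by
  obtain ⟨hpos, -, K, hK, tS⟩ := hasWeibullTail_weighted_sum hX hindep hw hone
  refine ⟨hpos, fun {Ω'} _ Q _ Z hZ => ?_⟩
  -- The weights -w satisfy the same hypotheses; their upper tail is the lower tail of the original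
  -- sum.
  obtain ⟨-, nS, K', hK', tS'⟩ := hasWeibullTail_weighted_sum (w := -w) hX hindep
    (by simpa using hw) (by simpa using hone)
  have hSm : AEMeasurable (fun ω => ∑ i, w i * X i ω) P :=
    Finset.aemeasurable_fun_sum _ fun i _ => (hX i).aemeasurable.const_mul _
  have hneg : (fun ω => ∑ i, (-w) i * X i ω) = fun ω => -∑ i, w i * X i ω := by
    ext ω
    simp
  have hZneg := (hZ.hasLaw_const_mul (-1)).map_eq
  simp only [neg_mul, one_mul, abs_neg, abs_of_pos hpos] at hZneg
  obtain ⟨L, hL, tZ⟩ := hasWeibullTail_weibullReal hZ.exponent_pos hpos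
  rw [sumScale_neg, hneg] at tS'
  rw [hneg] at nS
  refine ⟨upperTailEquivalent_of_hasWeibullTail hSm hZ.aemeasurable hK hL tS
    (by rwa [hZ.hasLaw_weibullReal.map_eq]),
    lowerTailEquivalent_of_hasWeibullTail_neg hSm hZ.aemeasurable hK' hL nS ?_ tS'
      (by rwa [hZneg])⟩
  rw [hZneg]
  exact nullSingletonClass_weibullReal hZ.exponent_pos hpos
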